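/- Let $P(\lambda)=P_m\lambda^m+\cdots+P_1\lambda+P_0$ be an $n\times n$ complex matrix polynomial with $\det P_m\neq 0$, all of whose eigenvalues (the zeros of $\det P(\lambda)$) are simple. Let $w(x)=\sum_{j=0}^m w_jx^j$ be a real polynomial with $w_j\ge 0$ for all $j$ and $w_0>0$. For $\varepsilon\ge 0$ let $\mathcal B(P,\varepsilon,w)$ be the set of all $Q(\lambda)=\sum_{j=0}^m Q_j\lambda^j$ with $\|Q_j-P_j\|\le\varepsilon w_j$ for $0\le j\le m$ (spectral norm), and let $$\Lambda_\varepsilon(P)=\{\mu\in\mathbb C:\det Q(\mu)=0\text{ for some }Q\in\mathcal B(P,\varepsilon,w)\}.$$ Let $$r(P)=\min\{\varepsilon>0:\text{some }Q\in\mathcal B(P,\varepsilon,w)\text{ has a multiple eigenvalue}\},$$ where $\mu\in\mathbb C$ is a multiple eigenvalue of $Q$ if it is a zero of $\det Q(\lambda)$ of order at least two (of infinite order if $\det Q\equiv0$). (a) Suppose that $\Lambda_{\varepsilon_0}(P)$ is bounded for some $\varepsilon_0>0$ such that $\Lambda_{\varepsilon_0}(P)$ has fewer than $nm$ connected components or some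 $Q\in\mathcal B(P,\varepsilon_0,w)$ has a multiple eigenvalue; or suppose that $nm\ge2$ and $\Lambda_\varepsilon(P)$ is bounded for all $\varepsilon>0$. Then the minimum defining $r(P)$ is attained, and $$r(P)=\min\{\varepsilon>0:\Lambda_\varepsilon(P)\text{ has fewer than }nm\text{ connected components}\}.$$ (b) Say that the number of connected components has decreased at $\varepsilon$ if $\Lambda_\varepsilon(P)$ has fewer connected components than $\Lambda_\delta(P)$ for some $0<\delta<\varepsilon$. Say that two different components meet at $\mu\in\mathbb C$ at level $\varepsilon$ if there are $z_1,z_2\in\mathbb C$ which, for every $0<\delta<\varepsilon$, do not lie in a common connected component of $\Lambda_\delta(P)$, such that for $i=1,2$ the point $\mu$ is in the closure of $\bigcup_{0<\delta<\varepsilon}G_i(\delta)$, where $G_i(\delta)$ is the connected component of $\Lambda_\delta(P)$ containing $z_i$ (empty if $z_i\notin\Lambda_\delta(P)$). Suppose that for some $\varepsilon_0>0$ the set $\Lambda_{\varepsilon_0}(P)$ is unbounded, the number of components has not decreased at any $\varepsilon<\varepsilon_0$, and two different components meet at some $\mu\in\mathbb C$, $\mu\neq0$, at level $\varepsilon_0$.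 Then the minimum defining $r(P)$ is attained, and $$r(P)=\min\{\varepsilon>0:\text{the number of connected components has decreased at }\varepsilon\}.$$ -/

import Mathlib

/-- An `n × n` complex matrix polynomial `P(z) = P_m z^m + ⋯ + P_1 z + P_0` of degree at most `m`,
given by its coefficients `P_0, …, P_m`. -/
abbrev MatPoly (n m : ℕ) : Type := Fin (m + 1) → Matrix (Fin n) (Fin n) ℂ

namespace MatPoly

variable {n m : ℕ}

/-- The value `P(z)`. -/
def eval (P : MatPoly n m) (z : ℂ) : Matrix (Fin n) (Fin n) ℂ :=
  ∑ j : Fin (m + 1), z ^ (j : ℕ) • P j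

/-- The scalar polynomial `det P(X)`. -/
noncomputable def detPoly (P : MatPoly n m) : Polynomial ℂ :=
  (∑ j : Fin (m + 1), (Polynomial.X ^ (j : ℕ) : Polynomial ℂ) • (P j).map Polynomial.C).det

/-- The spectrum `σ(P)`, i.e. the set of (finite) eigenvalues of `P`. -/
def eigenvalues (P : MatPoly n m) : Set ℂ :=
  {z | (P.eval z).det = 0}

/-- The algebraic multiplicity of `z`: its multiplicity as a zero of `det P(X)`. It is `⊤` if
`det P(X)` is the zero polynomial. -/
noncomputable def algMultiplicity (P : MatPoly n m) (z : ℂ) : ℕ∞ :=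
  emultiplicity (Polynomial.X - Polynomial.C z) P.detPoly

/-- `P` has a multiple eigenvalue. -/
def HasMultipleEigenvalue (P : MatPoly n m) : Prop :=
  ∃ z ∈ P.eigenvalues, 2 ≤ P.algMultiplicity z

open scoped Matrix.Norms.L2Operator in
/-- The set `B(P, ε, w)` of admissible perturbations: those `Q` with `‖Q_j - P_j‖ ≤ ε w_j` for
`j = 0, …, m`, in the spectral norm (the operator norm for the Euclidean vector norm). The weights
are the coefficients `w_0, …, w_m` of the polynomial `w`. -/
def perturbations (P : MatPoly n m) (w : Fin (m + 1) → ℝ) (ε : ℝ) : Set (MatPoly n m) :=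
  {Q | ∀ j, ‖Q j - P j‖ ≤ ε * w j}

/-- The `ε`-pseudospectrum of `P` with respect to `w`. -/
def pseudospectrum (P : MatPoly n m) (w : Fin (m + 1) → ℝ) (ε : ℝ) : Set ℂ :=
  {z | ∃ Q ∈ P.perturbations w ε, z ∈ Q.eigenvalues}

/-- The number of connected components of the `ε`-pseudospectrum. -/
noncomputable def numComponents (P : MatPoly n m) (w : Fin (m + 1) → ℝ) (ε : ℝ) : ℕ∞ :=
  ENat.card (ConnectedComponents (P.pseudospectrum w ε))

/-- The set of `ε > 0` for which some admissible perturbation has a multiple eigenvalue. -/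
def multipleLevels (P : MatPoly n m) (w : Fin (m + 1) → ℝ) : Set ℝ :=
  {ε | 0 < ε ∧ ∃ Q ∈ P.perturbations w ε, Q.HasMultipleEigenvalue}

/-- The distance `r(P)` from `P` to the matrix polynomials with multiple eigenvalues. -/
noncomputable def distMultiple (P : MatPoly n m) (w : Fin (m + 1) → ℝ) : ℝ :=
  sInf (P.multipleLevels w)

/-- The set of `ε > 0` for which the pseudospectrum has fewer than `n m` components. -/
def fewComponentsLevels (P : MatPoly n m) (w : Fin (m + 1) → ℝ) : Set ℝ :=
  {ε | 0 < ε ∧ P.numComponents w ε < ((n * m : ℕ) : ℕ∞)}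

/-- The set of `ε > 0` at which the number of components of the pseudospectrum has decreased, i.e.
is smaller than for some smaller positive value of the parameter. -/
def decreaseLevels (P : MatPoly n m) (w : Fin (m + 1) → ℝ) : Set ℝ :=
  {ε | 0 < ε ∧ ∃ δ, 0 < δ ∧ δ < ε ∧ P.numComponents w ε < P.numComponents w δ}

/-- As the parameter increases to `ε`, two different components of the pseudospectrum meet at the
point `μ`. The two components are followed as the components of `Λ_δ(P)` through two fixed points
`z₁`, `z₂`; they are different for all `δ < ε`, and `μ` is in the closure of the region swept out
by each of them for `δ < ε`. -/
def ComponentsMeetAt (P : MatPoly n m) (w : Fin (m + 1) → ℝ) (ε : ℝ) (μ : ℂ) : Prop :=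
  ∃ z₁ z₂ : ℂ,
    (∀ δ, 0 < δ → δ < ε → z₂ ∉ connectedComponentIn (P.pseudospectrum w δ) z₁) ∧
    μ ∈ closure (⋃ δ ∈ Set.Ioo 0 ε, connectedComponentIn (P.pseudospectrum w δ) z₁) ∧
    μ ∈ closure (⋃ δ ∈ Set.Ioo 0 ε, connectedComponentIn (P.pseudospectrum w δ) z₂)

end MatPoly

/-! Everything is compared with one event: two eigenvalues of `P` falling into one component of Λ_ε,
the failure of `SeparatesEigenvalues`.

A multiple eigenvalue causes the event. The perturbations form a compact connected set and the roots
of det Q move continuously with Q, so a clopen piece of Λ_ε holds equally many roots of every det Q.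
Hence each component contains an eigenvalue of `P`, and two of them if it contains a double root of
some det Q. When the degree may drop, roots escape through infinity; the substitution z = c + 1/x
with c outside Λ_ε restores compactness (`exists_isRoot_mem_connectedComponentIn`).

The event causes a multiple eigenvalue. At the first level where it occurs, the closures of two
swept regions share a point μ (`exists_componentsMeetAt`). Suppose μ is simple for every admissible
Q having it as an eigenvalue. Near such a Q the eigenvalue close to μ is a continuous function, and
its values at perturbations of lower level all lie in a region accumulating there, so membership in
a region is locally constant along the fibre {Q : det Q(μ) = 0}. The fibre is connected
(`isPreconnected_setOf_isRoot`), so the two regions overlap: a contradiction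
(`ComponentsMeetAt.exists_sq_dvd`). Connectedness of the fibre holds because some admissible Q has
Q(μ)x = 0 exactly when ‖P(μ)x‖ ≤ ε w(|μ|)‖x‖, a cone on which x and y or x and -y are joined by a
segment, while for fixed x the matrices Q form a convex set.

In (a) the first level exists by upper semicontinuity of Λ_ε. In (b) the meeting is given, and the
absence of earlier decreases keeps the eigenvalues separated at all lower levels. -/

open Polynomial Topology Filter Set

/-! ### Roots of polynomials depending continuously on a parameter. -/

/-- If `p` has no root at distance less than `ρ` from `z`, then its growth is controlled by its
value at `z`. -/
theorem Polynomial.norm_eval_le_of_forall_le_norm_sub {p : ℂ[X]} {N : ℕ} (hN : p.natDegree ≤ N)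
    {z : ℂ} {ρ : ℝ} (hρ : 0 < ρ) (h : ∀ a, p.IsRoot a → ρ ≤ ‖a - z‖) (x : ℂ) :
    ‖p.eval x‖ ≤ ‖p.eval z‖ * (1 + ‖x - z‖ / ρ) ^ N := by
  -- Factor by factor: ‖x - a‖ / ‖z - a‖ ≤ 1 + ‖x - z‖ / ρ for each root a.
  have key : ∀ s : Multiset ℂ, (∀ a ∈ s, ρ ≤ ‖a - z‖) →
      ‖(s.map (x - ·)).prod‖ ≤ ‖(s.map (z - ·)).prod‖ * (1 + ‖x - z‖ / ρ) ^ s.card := by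
    intro s
    induction s using Multiset.induction with
    | empty => simp
    | cons a s ih =>
      intro hs
      have h1 := ih fun b hb => hs b (Multiset.mem_cons_of_mem hb)
      have h2 : ρ ≤ ‖z - a‖ := by
        rw [norm_sub_rev]; exact hs a (Multiset.mem_cons_self a s)
      have h3 : ‖x - a‖ ≤ ‖z - a‖ * (1 + ‖x - z‖ / ρ) := by
        have h4 : ‖x - a‖ ≤ ‖x - z‖ + ‖z - a‖ := norm_sub_le_norm_sub_add_norm_sub x z a
        have h5 : ‖x - z‖ ≤ ‖z - a‖ * (‖x - z‖ / ρ) := by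
          rw [mul_div_assoc', le_div_iff₀ hρ, mul_comm]
          exact mul_le_mul_of_nonneg_right h2 (norm_nonneg _)
        linarith
      simp only [Multiset.map_cons, Multiset.prod_cons, norm_mul, Multiset.card_cons, pow_succ]
      calc _ ≤ (‖z - a‖ * (1 + ‖x - z‖ / ρ)) *
            (‖(s.map (z - ·)).prod‖ * (1 + ‖x - z‖ / ρ) ^ s.card) := by gcongr
        _ = _ := by ring
  rcases eq_or_ne p 0 with rfl | hp
  · simp
  have hs := IsAlgClosed.splits p
  rw [hs.eval_eq_prod_roots, hs.eval_eq_prod_roots z, norm_mul, norm_mul, mul_assoc]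
  refine mul_le_mul_of_nonneg_left ?_ (norm_nonneg _)
  refine (key _ fun a ha => h a (isRoot_of_mem_roots ha)).trans ?_
  refine mul_le_mul_of_nonneg_left ?_ (norm_nonneg _)
  refine pow_le_pow_right₀ ?_ ((card_roots' p).trans hN)
  have : 0 ≤ ‖x - z‖ / ρ := by positivity
  linarith

/-- A family of complex polynomials of degree at most `N` whose coefficients are continuous
functions of the parameter. -/
structure ContinuousPolyFamily {E : Type*} [TopologicalSpace E] (d : E → ℂ[X]) (N : ℕ) : Prop where
  continuous_coeff : ∀ k, Continuous fun b => (d b).coeff k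
  natDegree_le : ∀ b, (d b).natDegree ≤ N

namespace ContinuousPolyFamily

section TopologicalSpace

variable {E : Type*} [TopologicalSpace E] {d : E → ℂ[X]} {N : ℕ}

theorem continuous_eval (F : ContinuousPolyFamily d N) :
    Continuous fun p : E × ℂ => (d p.1).eval p.2 := by
  have : (fun p : E × ℂ => (d p.1).eval p.2) =
      fun p : E × ℂ => ∑ i ∈ Finset.range (N + 1), (d p.1).coeff i * p.2 ^ i := by
    ext p
    exact eval_eq_sum_range' (Nat.lt_succ_of_le (F.natDegree_le p.1)) p.2
  rw [this]
  refine continuous_finsetSum _ fun i _ => ?_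
  exact ((F.continuous_coeff i).comp continuous_fst).mul (continuous_snd.pow i)

theorem continuous_eval_const (F : ContinuousPolyFamily d N) (x : ℂ) :
    Continuous fun b => (d b).eval x :=
  F.continuous_eval.comp (continuous_id.prodMk continuous_const)

theorem derivative (F : ContinuousPolyFamily d N) :
    ContinuousPolyFamily (fun b => Polynomial.derivative (d b)) N where
  continuous_coeff k := by
    simp only [coeff_derivative]
    exact (F.continuous_coeff _).mul continuous_const
  natDegree_le b := (natDegree_derivative_le _).trans ((Nat.sub_le _ _).trans (F.natDegree_le b))

/-- Hurwitz's theorem: a root of a nonzero member of the family is approached by roots of the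
neighbouring members. -/
theorem eventually_exists_isRoot (F : ContinuousPolyFamily d N) {b₁ : E} {z : ℂ} (h0 : d b₁ ≠ 0)
    (hz : (d b₁).IsRoot z) {ρ : ℝ} (hρ : 0 < ρ) :
    ∀ᶠ b in 𝓝 b₁, ∃ x ∈ Metric.ball z ρ, (d b).IsRoot x := by
  obtain ⟨x, hx⟩ : ∃ x, (d b₁).eval x ≠ 0 := by
    by_contra! h
    exact h0 (Polynomial.funext fun x => by simpa using h x)
  -- The growth bound makes this difference nonnegative whenever `d b` has no root in the ball,
  -- while at `b₁` it is negative. Only an upper bound on the degree enters, so the degree may drop.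
  have hc : Continuous fun b => ‖(d b).eval z‖ * (1 + ‖x - z‖ / ρ) ^ N - ‖(d b).eval x‖ :=
    ((F.continuous_eval_const z).norm.mul continuous_const).sub (F.continuous_eval_const x).norm
  have h1 : ‖(d b₁).eval z‖ * (1 + ‖x - z‖ / ρ) ^ N - ‖(d b₁).eval x‖ < 0 := by
    rw [show (d b₁).eval z = 0 from hz]
    simpa using hx
  filter_upwards [hc.continuousAt.eventually_lt continuousAt_const h1] with b hb
  by_contra! h
  have := norm_eval_le_of_forall_le_norm_sub (F.natDegree_le b) hρ (z := z) (fun a ha => by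
    by_contra! hlt
    exact h a (by rwa [Metric.mem_ball, dist_eq_norm]) ha) x
  linarith

/-- The set of roots of the members with parameter in a compact set is closed. -/
theorem isClosed_setOf_exists_isRoot (F : ContinuousPolyFamily d N) {B : Set E}
    (hB : IsCompact B) : IsClosed {z | ∃ b ∈ B, (d b).IsRoot z} := by
  have : CompactSpace B := isCompact_iff_compactSpace.mp hB
  have hcl : IsClosed {p : B × ℂ | (d p.1).eval p.2 = 0} :=
    isClosed_eq (F.continuous_eval.comp
      ((continuous_subtype_val.comp continuous_fst).prodMk continuous_snd)) continuous_const
  convert isClosedMap_snd_of_compactSpace _ hcl using 1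
  ext z
  simp [IsRoot]

/-- If the leading coefficient does not vanish, the set of roots of the members with parameter in a
compact set is compact. -/
theorem isCompact_setOf_exists_isRoot (F : ContinuousPolyFamily d N) {B : Set E}
    (hB : IsCompact B) (hlead : ∀ b ∈ B, (d b).coeff N ≠ 0) :
    IsCompact {z | ∃ b ∈ B, (d b).IsRoot z} := by
  refine Metric.isCompact_of_isClosed_isBounded (F.isClosed_setOf_exists_isRoot hB) ?_
  rcases B.eq_empty_or_nonempty with rfl | hne
  · simp
  -- Cauchy's root bound with the supremum of the coefficients replaced by their sum, whose
  -- continuity is immediate.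
  have hcont : ContinuousOn
      (fun b => (∑ i ∈ Finset.range N, ‖(d b).coeff i‖) / ‖(d b).coeff N‖ + 1) B := by
    refine ContinuousOn.add (ContinuousOn.div ?_ (F.continuous_coeff N).norm.continuousOn
      fun b hb => norm_ne_zero_iff.mpr (hlead b hb)) continuousOn_const
    exact (continuous_finsetSum _ fun i _ => (F.continuous_coeff i).norm).continuousOn
  obtain ⟨M, hM⟩ := (hB.image_of_continuousOn hcont).bddAbove
  refine isBounded_iff_forall_norm_le.mpr ⟨M, ?_⟩
  rintro z ⟨b, hb, hz⟩
  refine le_trans ?_ (hM ⟨b, hb, rfl⟩)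
  have hdeg : (d b).natDegree = N :=
    le_antisymm (F.natDegree_le b) (le_natDegree_of_ne_zero (hlead b hb))
  have h0 : d b ≠ 0 := fun h => hlead b hb (by simp [h])
  refine (NNReal.coe_lt_coe.mpr (hz.norm_lt_cauchyBound h0)).le.trans ?_
  simp only [cauchyBound, NNReal.coe_add, NNReal.coe_div, NNReal.coe_one, coe_nnnorm,
    Polynomial.leadingCoeff, hdeg]
  gcongr
  have : (Finset.range N).sup (fun i => ‖(d b).coeff i‖₊) ≤
      ∑ i ∈ Finset.range N, ‖(d b).coeff i‖₊ :=
    Finset.sup_le fun i hi => Finset.single_le_sum (f := fun i => ‖(d b).coeff i‖₊)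
      (fun _ _ => zero_le) hi
  simpa using NNReal.coe_le_coe.mpr this

end TopologicalSpace

section Normed

variable {E : Type*} [SeminormedAddCommGroup E] {d : E → ℂ[X]} {N : ℕ}

/-- Near a simple root, the root is a continuous function of the parameter. -/
theorem exists_continuousOn_isRoot (F : ContinuousPolyFamily d N) {b₀ : E} {μ : ℂ}
    (hμ : (d b₀).IsRoot μ) (hμ' : (Polynomial.derivative (d b₀)).eval μ ≠ 0) :
    ∃ r > 0, ∃ ρ > 0, ∃ g : E → ℂ, ContinuousOn g (Metric.ball b₀ r) ∧
      ∀ b ∈ Metric.ball b₀ r, (d b).IsRoot (g b) ∧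
        ∀ z ∈ Metric.ball μ ρ, (d b).IsRoot z → z = g b := by
  set a := (Polynomial.derivative (d b₀)).eval μ with ha
  have ha0 : 0 < ‖a‖ := norm_pos_iff.mpr hμ'
  have hcont : ContinuousAt (fun p : E × ℂ => ‖(Polynomial.derivative (d p.1)).eval p.2 - a‖)
      (b₀, μ) := (F.derivative.continuous_eval.sub continuous_const).norm.continuousAt
  have hev := hcont.eventually_lt (g := fun _ => ‖a‖ / 2) continuousAt_const (by simp [← ha, ha0])
  obtain ⟨ρ, hρ, hball⟩ := Metric.eventually_nhds_iff_ball.mp hev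
  have h0 : d b₀ ≠ 0 := fun h => by simp [h] at ha; exact hμ' ha
  -- The half radius leaves room: a root within ρ/2 of `g b` is still in the ball of radius ρ, where
  -- roots are unique.
  obtain ⟨r₁, hr₁, hex⟩ := Metric.eventually_nhds_iff_ball.mp
    (F.eventually_exists_isRoot h0 hμ (half_pos hρ))
  have hder : ∀ b ∈ Metric.ball b₀ (min r₁ ρ), ∀ z ∈ Metric.ball μ ρ,
      ‖(Polynomial.derivative (d b)).eval z - a‖ < ‖a‖ / 2 := by
    intro b hb z hz
    refine hball (b, z) ?_
    rw [← ball_prod_same]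
    exact ⟨Metric.ball_subset_ball (min_le_right _ _) hb, hz⟩
  -- By the mean value inequality x ↦ d_b(x) - a x is ‖a‖/2-Lipschitz on the ball, so d_b is
  -- injective there.
  have hinj : ∀ b ∈ Metric.ball b₀ (min r₁ ρ), ∀ z ∈ Metric.ball μ ρ, ∀ z' ∈ Metric.ball μ ρ,
      (d b).IsRoot z → (d b).IsRoot z' → z = z' := by
    intro b hb z hz z' hz' h h'
    have hle : ‖((d b).eval z' - a * z') - ((d b).eval z - a * z)‖ ≤ ‖a‖ / 2 * ‖z' - z‖ := by
      refine (convex_ball μ ρ).norm_image_sub_le_of_norm_hasDerivWithin_le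
        (f := fun x => (d b).eval x - a * x)
        (f' := fun x => (Polynomial.derivative (d b)).eval x - a)
        (fun x _ => ?_) (fun x hx => (hder b hb x hx).le) hz hz'
      have := ((d b).hasDerivAt x).sub ((hasDerivAt_id x).const_mul a)
      rw [mul_one] at this
      exact this.hasDerivWithinAt
    rw [show (d b).eval z = 0 from h, show (d b).eval z' = 0 from h', zero_sub, zero_sub,
      neg_sub_neg, ← mul_sub, norm_mul, norm_sub_rev z z'] at hle
    by_contra hne
    have : 0 < ‖z' - z‖ := norm_pos_iff.mpr (sub_ne_zero.mpr (Ne.symm hne))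
    nlinarith
  choose! g hg hgroot using hex
  refine ⟨min r₁ ρ, lt_min hr₁ hρ, ρ, hρ, g, ?_, ?_⟩
  · intro b hb
    have hb₁ := Metric.ball_subset_ball (min_le_left r₁ ρ) hb
    have hgb := hg b hb₁
    have hb0 : d b ≠ 0 := by
      intro h
      have := hder b hb μ (Metric.mem_ball_self hρ)
      rw [h] at this
      simp at this
      linarith
    refine ContinuousAt.continuousWithinAt ?_
    rw [Metric.continuousAt_iff']
    intro η hη
    filter_upwards [F.eventually_exists_isRoot hb0 (hgroot b hb₁) (lt_min hη (half_pos hρ)),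
      Metric.isOpen_ball.mem_nhds hb] with c ⟨x, hx, hxr⟩ hc
    have hc₁ := Metric.ball_subset_ball (min_le_left r₁ ρ) hc
    have hgc := hg c hc₁
    rw [Metric.mem_ball] at hx hgb hgc
    have hxμ : x ∈ Metric.ball μ ρ := by
      rw [Metric.mem_ball]
      have h1 := dist_triangle x (g b) μ
      have h2 := hx.trans_le (min_le_right _ _)
      linarith
    have : g c = x := hinj c hc _ (by rw [Metric.mem_ball]; linarith) _ hxμ (hgroot c hc₁) hxr
    rw [this]
    exact hx.trans_le (min_le_left _ _)
  · intro b hb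
    have hb₁ := Metric.ball_subset_ball (min_le_left r₁ ρ) hb
    refine ⟨hgroot b hb₁, fun z hz hzr => hinj b hb z hz _ ?_ hzr (hgroot b hb₁)⟩
    exact Metric.ball_subset_ball (by linarith) (hg b hb₁)

end Normed

end ContinuousPolyFamily

/-! ### Clopen separation and conservation of the number of roots. -/

/-- In a compact Hausdorff subspace, finitely many points outside the component of `z` are separated
from `z` by a clopen set. -/
theorem IsCompact.exists_isCompact_separation {X : Type*} [TopologicalSpace X] [T2Space X]
    {S : Set X} (hS : IsCompact S) {z : X} (hz : z ∈ S) (T : Finset X) :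
    ∃ K K' : Set X, IsCompact K ∧ IsCompact K' ∧ Disjoint K K' ∧ K ∪ K' = S ∧
      connectedComponentIn S z ⊆ K ∧ ∀ a ∈ T, a ∈ K → a ∈ connectedComponentIn S z := by
  classical
  have : CompactSpace S := isCompact_iff_compactSpace.mp hS
  have hsep : ∀ a : X, ∃ Z : Set S, IsClopen Z ∧ (⟨z, hz⟩ : S) ∈ Z ∧
      (∀ h : a ∈ S, (⟨a, h⟩ : S) ∈ Z → a ∈ connectedComponentIn S z) := by
    intro a
    by_cases ha : a ∈ S ∧ a ∉ connectedComponentIn S z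
    · obtain ⟨haS, ha⟩ := ha
      have h1 : (⟨a, haS⟩ : S) ∉ connectedComponent (⟨z, hz⟩ : S) := by
        intro h
        rw [connectedComponentIn_eq_image hz] at ha
        exact ha ⟨_, h, rfl⟩
      -- In a compact Hausdorff space components coincide with quasi-components.
      rw [connectedComponent_eq_iInter_isClopen] at h1
      simp only [mem_iInter, not_forall] at h1
      obtain ⟨⟨Z, hZ, hzZ⟩, haZ⟩ := h1
      exact ⟨Z, hZ, hzZ, fun _ h => absurd h haZ⟩
    · exact ⟨univ, isClopen_univ, mem_univ _, fun h _ => by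
        by_contra h'; exact ha ⟨h, h'⟩⟩
  choose Z hZ hzZ haZ using hsep
  have hclop : IsClopen (⋂ a ∈ T, Z a) := T.finite_toSet.isClopen_biInter fun a _ => hZ a
  refine ⟨Subtype.val '' (⋂ a ∈ T, Z a), Subtype.val '' (⋂ a ∈ T, Z a)ᶜ,
    hclop.1.isCompact.image continuous_subtype_val,
    hclop.compl.1.isCompact.image continuous_subtype_val, ?_, ?_, ?_, ?_⟩
  · exact (disjoint_image_iff Subtype.val_injective).mpr disjoint_compl_right
  · rw [← image_union, union_compl_self, image_univ, Subtype.range_coe]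
  · rw [connectedComponentIn_eq_image hz]
    refine image_mono (hclop.connectedComponent_subset ?_)
    simp [hzZ]
  · rintro a ha ⟨⟨y, hy⟩, hyZ, rfl⟩
    simp only [mem_iInter] at hyZ
    exact haZ y hy (hyZ y ha)

theorem Multiset.countP_le_countP_of_forall_mem {α : Type*} {p q : α → Prop} [DecidablePred p]
    [DecidablePred q] {s : Multiset α} (h : ∀ x ∈ s, p x → q x) : s.countP p ≤ s.countP q := by
  induction s using Quotient.inductionOn with
  | h l => exact List.countP_mono_left fun x hx hp => by simpa using h x hx (by simpa using hp)

namespace ContinuousPolyFamily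

variable {E : Type*} [TopologicalSpace E] [T2Space E] {d : E → ℂ[X]} {N : ℕ}

open Classical in
/-- If the roots of all members stay in two disjoint compact sets, the number of roots in one of
them is constant. -/
theorem countP_roots_eq (F : ContinuousPolyFamily d N) {B : Set E} (hB : IsCompact B)
    (hBc : IsPreconnected B) (hlead : ∀ b ∈ B, (d b).coeff N ≠ 0) {K K' : Set ℂ}
    (hK : IsCompact K) (hK' : IsCompact K') (hKK : Disjoint K K')
    (hcover : ∀ b ∈ B, ∀ z, (d b).IsRoot z → z ∈ K ∪ K') {b b' : E} (hb : b ∈ B) (hb' : b' ∈ B) :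
    (d b).roots.countP (· ∈ K) = (d b').roots.countP (· ∈ K) := by
  have hdeg : ∀ b ∈ B, (d b).natDegree = N := fun b hb =>
    le_antisymm (F.natDegree_le b) (le_natDegree_of_ne_zero (hlead b hb))
  -- Parameters paired with an ordered list of all N roots, the indices in `I` marking those in `K`.
  -- These sets are compact, so their projections are closed; finitely many closed level sets make
  -- the count continuous, without any contour integral.
  let V : Finset (Fin N) → Set (E × (Fin N → ℂ)) := fun I =>
    (B ×ˢ univ.pi fun i => if i ∈ I then K else K') ∩
      {p | ∀ z, (d p.1).eval z = (d p.1).coeff N * ∏ i, (z - p.2 i)}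
  have hV : ∀ I, IsCompact (V I) := by
    intro I
    refine (hB.prod (isCompact_univ_pi fun i => ?_)).inter_right ?_
    · split_ifs
      exacts [hK, hK']
    · simp only [ofPred_forall]
      refine isClosed_iInter fun z => isClosed_eq
        ((F.continuous_eval_const z).comp continuous_fst) ?_
      refine ((F.continuous_coeff N).comp continuous_fst).mul ?_
      exact continuous_finsetProd _ fun i _ =>
        continuous_const.sub ((continuous_apply i).comp continuous_snd)
  have hroots : ∀ p : E × (Fin N → ℂ), p.1 ∈ B →
      (∀ z, (d p.1).eval z = (d p.1).coeff N * ∏ i, (z - p.2 i)) →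
      (d p.1).roots = Finset.univ.val.map p.2 := by
    intro p hp h
    have : d p.1 = C ((d p.1).coeff N) * ∏ i, (X - C (p.2 i)) := by
      refine Polynomial.funext fun z => ?_
      rw [h z]
      simp [eval_prod]
    rw [this, roots_C_mul _ (hlead _ hp), Finset.prod_eq_multiset_prod]
    rw [← Function.comp_def (fun a => X - C a) p.2, ← Multiset.map_map]
    exact roots_multiset_prod_X_sub_C _
  have hcard : ∀ k, {b | b ∈ B ∧ (d b).roots.countP (· ∈ K) = k} =
      ⋃ I ∈ {I : Finset (Fin N) | I.card = k}, Prod.fst '' V I := by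
    intro k
    ext b
    simp only [mem_ofPred_eq, mem_iUnion, mem_image, exists_prop]
    constructor
    · rintro ⟨hb, hk⟩
      have hs := IsAlgClosed.splits (d b)
      have hc : (d b).roots.toList.length = N := by
        rw [Multiset.length_toList, ← hs.natDegree_eq_card_roots, hdeg b hb]
      let r : Fin N → ℂ := fun i => (d b).roots.toList.get (i.cast hc.symm)
      have hr : Finset.univ.val.map r = (d b).roots := by
        conv_rhs => rw [← Multiset.coe_toList (d b).roots]
        rw [Fin.univ_val_map]
        congr 1
        refine List.ext_get (by simp [hc]) fun i h1 h2 => by simp [r]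
      have heval : ∀ z, (d b).eval z = (d b).coeff N * ∏ i, (z - r i) := by
        intro z
        rw [hs.eval_eq_prod_roots, Polynomial.leadingCoeff, hdeg b hb, ← hr, Multiset.map_map]
        rfl
      have hrb : ∀ i, (d b).IsRoot (r i) := fun i => by
        refine isRoot_of_mem_roots ?_
        rw [← hr]
        exact Multiset.mem_map_of_mem _ (Finset.mem_univ i)
      refine ⟨Finset.univ.filter fun i => r i ∈ K, ?_, (b, r), ⟨⟨hb, ?_⟩, heval⟩, rfl⟩
      · rw [← hk, ← hr, Multiset.countP_map, Finset.card_def, Finset.filter_val]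
      · intro i _
        by_cases hi : r i ∈ K
        · simp [hi]
        · simpa [hi] using (hcover b hb _ (hrb i)).resolve_left hi
    · rintro ⟨I, hI, p, ⟨⟨hp, hpK⟩, heval⟩, rfl⟩
      refine ⟨hp, ?_⟩
      rw [hroots p hp heval, Multiset.countP_map, ← hI, Finset.card_def, ← Finset.filter_val]
      congr 2
      ext i
      have hi := hpK i (mem_univ i)
      simp only [Finset.mem_filter, Finset.mem_univ, true_and]
      by_cases hiI : i ∈ I
      · simpa [hiI] using hi
      · simp only [hiI, if_false, iff_false] at hi ⊢
        exact fun h => hKK.le_bot ⟨h, hi⟩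
  have : PreconnectedSpace B := isPreconnected_iff_preconnectedSpace.mp hBc
  have hcont : Continuous fun b : B => (d b).roots.countP (· ∈ K) := by
    rw [continuous_iff_isClosed]
    intro s _
    have : (fun b : B => (d b).roots.countP (· ∈ K)) ⁻¹' s =
        Subtype.val ⁻¹' ⋃ k ∈ {k | k ∈ s ∧ k ≤ N}, {b | b ∈ B ∧ (d b).roots.countP (· ∈ K) = k} := by
      ext ⟨b, hb⟩
      simp only [mem_preimage, mem_iUnion, mem_ofPred_eq, exists_prop]
      refine ⟨fun h => ⟨_, ⟨h, ?_⟩, hb, rfl⟩, ?_⟩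
      · exact (Multiset.countP_le_card _ _).trans ((card_roots' _).trans (F.natDegree_le b))
      · rintro ⟨k, ⟨hk, -⟩, -, rfl⟩
        exact hk
    rw [this]
    refine IsClosed.preimage continuous_subtype_val ?_
    refine ((finite_Iic N).subset fun k hk => hk.2).isClosed_biUnion fun k _ => ?_
    rw [hcard k]
    exact (toFinite _).isClosed_biUnion fun I _ => ((hV I).image continuous_fst).isClosed
  exact PreconnectedSpace.constant ‹_› hcont (x := ⟨b, hb⟩) (y := ⟨b', hb'⟩)

open Classical in
/-- The multiplicity of a root of any member is at most the number of roots of a fixed member in the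
component of that root in the set of all roots. -/
theorem count_roots_le_countP (F : ContinuousPolyFamily d N) {B : Set E} (hB : IsCompact B)
    (hBc : IsPreconnected B) (hlead : ∀ b ∈ B, (d b).coeff N ≠ 0) {b₀ b : E} (hb₀ : b₀ ∈ B)
    (hb : b ∈ B) (z : ℂ) :
    (d b).roots.count z ≤ (d b₀).roots.countP
      (· ∈ connectedComponentIn {z | ∃ b ∈ B, (d b).IsRoot z} z) := by
  by_cases hz : z ∈ (d b).roots
  swap
  · simp [Multiset.count_eq_zero_of_notMem hz]
  have hzS : z ∈ {z | ∃ b ∈ B, (d b).IsRoot z} := ⟨b, hb, isRoot_of_mem_roots hz⟩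
  -- `K` may exceed the component of `z`, but it contains no further root of `d b₀`.
  obtain ⟨K, K', hK, hK', hKK, hcover, hzK, hT⟩ :=
    (F.isCompact_setOf_exists_isRoot hB hlead).exists_isCompact_separation hzS (d b₀).roots.toFinset
  have h1 := F.countP_roots_eq hB hBc hlead hK hK' hKK
    (fun b hb z hz => by rw [hcover]; exact ⟨b, hb, hz⟩) hb hb₀
  calc (d b).roots.count z ≤ (d b).roots.countP (· ∈ K) :=
        Multiset.countP_le_countP_of_forall_mem fun x _ hx => by
          subst hx; exact hzK (mem_connectedComponentIn hzS)
    _ = (d b₀).roots.countP (· ∈ K) := h1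
    _ ≤ _ := Multiset.countP_le_countP_of_forall_mem fun x hx hxK =>
        hT x (Multiset.mem_toFinset.mpr hx) hxK

end ContinuousPolyFamily

/-! ### Punctured sets and the change of variable z = c + 1/x. -/

theorem isPreconnected_ball_diff_zero (ρ : ℝ) :
    IsPreconnected (Metric.ball (0 : ℂ) ρ \ {0}) := by
  rcases le_or_gt ρ 0 with hρ | hρ
  · simp [Metric.ball_eq_empty.mpr hρ, isPreconnected_empty]
  have : Metric.ball (0 : ℂ) ρ \ {0} = Complex.exp '' {z | z.re < Real.log ρ} := by
    ext z
    simp only [Set.mem_sdiff, mem_ball_zero_iff, mem_singleton_iff, mem_image, mem_ofPred_eq]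
    constructor
    · rintro ⟨hz, h0⟩
      refine ⟨Complex.log z, ?_, Complex.exp_log h0⟩
      rw [Complex.log_re]
      exact Real.log_lt_log (norm_pos_iff.mpr h0) hz
    · rintro ⟨y, hy, rfl⟩
      refine ⟨?_, Complex.exp_ne_zero y⟩
      rw [Complex.norm_exp]
      exact (Real.lt_log_iff_exp_lt hρ).mp hy
  rw [this]
  exact (convex_halfSpace_re_lt _).isPreconnected.image _ Complex.continuous_exp.continuousOn

/-- The punctured disc is connected, so it lies on one side of any separation of S ∖ {0}; adding 0
to that side would separate S. -/
theorem IsPreconnected.diff_zero {S : Set ℂ} (hS : IsPreconnected S) {ρ : ℝ} (hρ : 0 < ρ)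
    (hball : Metric.ball 0 ρ ⊆ S) : IsPreconnected (S \ {0}) := by
  have key : ∀ U V : Set ℂ, IsOpen U → IsOpen V → S \ {0} ⊆ U ∪ V →
      ((S \ {0}) ∩ V).Nonempty → Metric.ball 0 ρ \ {0} ⊆ U →
      ((S \ {0}) ∩ (U ∩ V)).Nonempty := by
    rintro U V hU hV hUV ⟨y, ⟨hyS, hy0⟩, hyV⟩ hb
    by_cases hyU : y ∈ U
    · exact ⟨y, ⟨hyS, hy0⟩, hyU, hyV⟩
    have hyρ : y ∉ Metric.ball (0 : ℂ) ρ := fun h => hyU (hb ⟨h, hy0⟩)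
    -- A smaller closed disc is removed from the other side, so that the common point found is not
    -- 0.
    obtain ⟨x, hxS, hxU, hxV, hxρ⟩ := hS (U ∪ Metric.ball 0 ρ)
      (V ∩ (Metric.closedBall 0 (ρ / 2))ᶜ) (hU.union Metric.isOpen_ball)
      (hV.inter Metric.isClosed_closedBall.isOpen_compl) (by
        intro x hx
        by_cases hxb : x ∈ Metric.ball (0 : ℂ) ρ
        · exact Or.inl (Or.inr hxb)
        · have hx0 : x ≠ 0 := by
            rintro rfl; exact hxb (Metric.mem_ball_self hρ)
          rcases hUV ⟨hx, hx0⟩ with h | h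
          · exact Or.inl (Or.inl h)
          · exact Or.inr ⟨h, fun h' => hxb (Metric.closedBall_subset_ball (by linarith) h')⟩)
      ⟨0, hball (Metric.mem_ball_self hρ), Or.inr (Metric.mem_ball_self hρ)⟩
      ⟨y, hyS, hyV, fun h' => hyρ (Metric.closedBall_subset_ball (by linarith) h')⟩
    have hx0 : x ≠ 0 := by
      rintro rfl; exact hxρ (Metric.mem_closedBall_self (by linarith))
    exact ⟨x, ⟨hxS, hx0⟩, hxU.elim id fun h => hb ⟨h, hx0⟩, hxV⟩
  intro U V hU hV hUV hSU hSV
  by_cases h : ((Metric.ball 0 ρ \ {0}) ∩ V).Nonempty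
  · by_cases h' : ((Metric.ball 0 ρ \ {0}) ∩ U).Nonempty
    · exact ((isPreconnected_ball_diff_zero ρ) U V hU hV
        ((sdiff_subset_sdiff_left hball).trans hUV) h' h).mono
        (inter_subset_inter_left _ (sdiff_subset_sdiff_left hball))
    · rw [inter_comm U V]
      refine key V U hV hU (by rwa [union_comm]) hSU fun x hx => ?_
      exact (hUV (sdiff_subset_sdiff_left hball hx)).elim (fun hxU => absurd ⟨x, hx, hxU⟩ h') id
  · refine key U V hU hV hUV hSV fun x hx => ?_
    exact (hUV (sdiff_subset_sdiff_left hball hx)).elim id (fun hxV => absurd ⟨x, hx, hxV⟩ h)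

namespace Polynomial

/-- Reflection e ↦ X^N e(1/X) is multiplicative when the degree bound is split as 2 + (N - 2), and
it sends X - a to -a(X - 1/a). -/
theorem sq_dvd_reflect {e : ℂ[X]} {N : ℕ} (hN : e.natDegree ≤ N) {a : ℂ} (ha : a ≠ 0)
    (h : (X - C a) ^ 2 ∣ e) : (X - C a⁻¹) ^ 2 ∣ e.reflect N := by
  rcases eq_or_ne e 0 with rfl | he
  · simp
  obtain ⟨q, rfl⟩ := h
  have hq : q ≠ 0 := right_ne_zero_of_mul he
  have hdeg : ((X - C a) ^ 2 * q).natDegree = 2 + q.natDegree := by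
    rw [natDegree_mul (pow_ne_zero _ (X_sub_C_ne_zero a)) hq, natDegree_pow, natDegree_X_sub_C]
  have h1 : reflect 1 (X - C a) = C (-a) * (X - C a⁻¹) := by
    rw [sub_eq_add_neg, ← C_neg, reflect_add, reflect_one_X, reflect_C, mul_sub, ← C_mul]
    simp [ha]
    ring
  have h2 : reflect 2 ((X - C a) ^ 2) = (C (-a) * (X - C a⁻¹)) ^ 2 := by
    rw [sq, sq, ← h1]
    exact reflect_mul (F := 1) (G := 1) _ _ (by simp) (by simp)
  rw [show N = 2 + (N - 2) by lia, reflect_mul _ _ (by simp) (by lia), h2]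
  exact ⟨C (-a) ^ 2 * reflect (N - 2) q, by ring⟩

theorem sq_dvd_comp_X_add_C {p : ℂ[X]} {z : ℂ} (c : ℂ) (h : (X - C z) ^ 2 ∣ p) :
    (X - C (z - c)) ^ 2 ∣ p.comp (X + C c) := by
  obtain ⟨q, rfl⟩ := h
  refine ⟨q.comp (X + C c), ?_⟩
  simp only [mul_comp, pow_comp, sub_comp, X_comp, C_comp, C_sub]
  ring

/-- The polynomial `X ^ N * p (c + X⁻¹)`. -/
noncomputable def chart (N : ℕ) (c : ℂ) (p : ℂ[X]) : ℂ[X] := reflect N (p.comp (X + C c))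

variable {p : ℂ[X]} {N : ℕ} {c : ℂ}

theorem natDegree_comp_X_add_C (p : ℂ[X]) (c : ℂ) : (p.comp (X + C c)).natDegree = p.natDegree := by
  rw [natDegree_comp, natDegree_X_add_C, mul_one]

theorem natDegree_chart_le (hp : p.natDegree ≤ N) : (chart N c p).natDegree ≤ N :=
  natDegree_reflect_le.trans (by rw [natDegree_comp_X_add_C]; exact max_le le_rfl hp)

/-- A point c outside the set of all roots thus gives every member full degree in the chart. -/
theorem coeff_chart : (chart N c p).coeff N = p.eval c := by
  simp [chart, coeff_reflect, coeff_zero_eq_eval_zero, eval_comp]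

/-- The point 0 of the chart stands for infinity: the value there is the coefficient of degree N. -/
theorem eval_zero_chart_ne_zero (hp : p.natDegree = N) (h0 : p ≠ 0) : (chart N c p).eval 0 ≠ 0 := by
  rw [← coeff_zero_eq_eval_zero, chart, coeff_reflect, revAt_zero]
  rw [← hp, ← natDegree_comp_X_add_C p c, coeff_natDegree, leadingCoeff_ne_zero]
  intro h
  have h1 := congrArg (fun q => q.comp (X - C c)) h
  simp [comp_assoc] at h1
  exact h0 h1

theorem isRoot_chart_iff (hp : p.natDegree ≤ N) {x : ℂ} (hx : x ≠ 0) :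
    (chart N c p).IsRoot x ↔ p.IsRoot (c + x⁻¹) := by
  have : Invertible x := invertibleOfNonzero hx
  have : Invertible x⁻¹ := invertibleOfNonzero (inv_ne_zero hx)
  have h := eval₂_reflect_eq_zero_iff (RingHom.id ℂ) x⁻¹ N (p.comp (X + C c))
    (by rwa [natDegree_comp_X_add_C])
  have h2 : ⅟ x⁻¹ = x := by simp
  rw [h2] at h
  simpa [chart, IsRoot, eval₂_eq_eval_map, eval_comp, add_comm] using h

theorem sq_dvd_chart (hp : p.natDegree ≤ N) {z : ℂ} (hz : z ≠ c) (h : (X - C z) ^ 2 ∣ p) :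
    (X - C (z - c)⁻¹) ^ 2 ∣ chart N c p :=
  sq_dvd_reflect (by rwa [natDegree_comp_X_add_C]) (sub_ne_zero.mpr hz) (sq_dvd_comp_X_add_C c h)

theorem sq_dvd_of_sq_dvd_chart (hp : p.natDegree ≤ N) {x : ℂ} (hx : x ≠ 0)
    (h : (X - C x) ^ 2 ∣ chart N c p) : (X - C (c + x⁻¹)) ^ 2 ∣ p := by
  have h1 := sq_dvd_reflect (natDegree_chart_le hp) hx h
  rw [chart, reflect_reflect] at h1
  have h2 := sq_dvd_comp_X_add_C (-c) h1
  rw [comp_assoc] at h2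
  simpa [add_comm] using h2

end Polynomial

namespace ContinuousPolyFamily

variable {E : Type*} [TopologicalSpace E] {d : E → ℂ[X]} {N : ℕ}

theorem chart (F : ContinuousPolyFamily d N) (c : ℂ) :
    ContinuousPolyFamily (fun b => Polynomial.chart N c (d b)) N where
  continuous_coeff k := by
    have : (fun b => (Polynomial.chart N c (d b)).coeff k) = fun b =>
        ∑ i ∈ Finset.range (N + 1), (d b).coeff i * ((X + C c) ^ i : ℂ[X]).coeff (revAt N k) := by
      ext b
      rw [Polynomial.chart, coeff_reflect, comp, eval₂_eq_sum_range' C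
        (Nat.lt_succ_of_le (F.natDegree_le b)), finsetSum_coeff]
      simp
    rw [this]
    exact continuous_finsetSum _ fun i _ => (F.continuous_coeff i).mul continuous_const
  natDegree_le b := natDegree_chart_le (F.natDegree_le b)

variable [T2Space E]

open Classical in
/-- Consider the set `Λ` of all roots of a family over a compact connected parameter space. If `Λ` is
not the plane, and is bounded or contains a neighbourhood of infinity, then each component of `Λ`
contains a root of any given member of full degree, and if the component contains a multiple root of
some member, it contains two roots of that given member, provided that those are simple. -/
theorem exists_isRoot_mem_connectedComponentIn (F : ContinuousPolyFamily d N) {B : Set E}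
    (hB : IsCompact B) (hBc : IsPreconnected B) {b₀ : E} (hb₀ : b₀ ∈ B) (h0 : (d b₀).coeff N ≠ 0)
    {Λ : Set ℂ} (hΛ : Λ = {z | ∃ b ∈ B, (d b).IsRoot z}) (huniv : Λ ≠ univ)
    (hgood : Bornology.IsBounded Λ ∨ ∃ R : ℝ, ∀ z, R < ‖z‖ → z ∈ Λ)
    {b : E} (hb : b ∈ B) {z : ℂ} (hz : (d b).IsRoot z) :
    (∃ a ∈ connectedComponentIn Λ z, (d b₀).IsRoot a) ∧
      ((X - C z) ^ 2 ∣ d b → (∀ a, ¬ (X - C a) ^ 2 ∣ d b₀) →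
        ∃ a ∈ connectedComponentIn Λ z, ∃ a' ∈ connectedComponentIn Λ z, a ≠ a' ∧
          (d b₀).IsRoot a ∧ (d b₀).IsRoot a') := by
  obtain ⟨c, hc⟩ := (ne_univ_iff_exists_notMem Λ).mp huniv
  have hzΛ : z ∈ Λ := by rw [hΛ]; exact ⟨b, hb, hz⟩
  have hzc : z ≠ c := by rintro rfl; exact hc hzΛ
  have hdeg0 : (d b₀).natDegree = N :=
    le_antisymm (F.natDegree_le b₀) (le_natDegree_of_ne_zero h0)
  have hd0 : d b₀ ≠ 0 := fun h => h0 (by simp [h])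
  set Φ := F.chart c
  set S : Set ℂ := {x | ∃ b ∈ B, (Polynomial.chart N c (d b)).IsRoot x} with hS
  have hlead : ∀ b ∈ B, (Polynomial.chart N c (d b)).coeff N ≠ 0 := by
    intro b hb h
    rw [coeff_chart] at h
    exact hc (by rw [hΛ]; exact ⟨b, hb, h⟩)
  have hne : ∀ b ∈ B, Polynomial.chart N c (d b) ≠ 0 := fun b hb h => hlead b hb (by simp [h])
  have hmem : ∀ x, x ≠ 0 → (x ∈ S ↔ c + x⁻¹ ∈ Λ) := by
    intro x hx
    rw [hΛ]
    exact exists_congr fun b => and_congr_right fun _ => isRoot_chart_iff (F.natDegree_le b) hx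
  have hroot0 : ¬ (Polynomial.chart N c (d b₀)).IsRoot 0 := eval_zero_chart_ne_zero hdeg0 hd0
  have hcount : ∀ b ∈ B, ∀ x, (Polynomial.chart N c (d b)).roots.count x ≤
      (Polynomial.chart N c (d b₀)).roots.countP (· ∈ connectedComponentIn S x) :=
    fun b hb x => Φ.count_roots_le_countP hB hBc hlead hb₀ hb x
  have hexists : ∀ x ∈ S, ∃ y ∈ connectedComponentIn S x,
      (Polynomial.chart N c (d b₀)).IsRoot y := by
    rintro x ⟨b, hb, hx⟩
    have h1 : 0 < (Polynomial.chart N c (d b)).roots.count x :=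
      Multiset.count_pos.mpr ((mem_roots (hne b hb)).mpr hx)
    obtain ⟨y, hy, hyC⟩ := Multiset.countP_pos.mp (h1.trans_le (hcount b hb x))
    exact ⟨y, hyC, isRoot_of_mem_roots hy⟩
  -- A component in the chart may pass through 0, which is not the image of a point of Λ. If Λ is
  -- bounded, 0 would be a component by itself without a root of the chart of `d b₀`, against
  -- `hexists`; otherwise a whole disc about 0 lies in the component and can be punctured.
  have hpunct : ∀ x, IsPreconnected (connectedComponentIn S x \ {0}) := by
    intro x
    by_cases h0C : (0 : ℂ) ∈ connectedComponentIn S x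
    swap
    · rw [sdiff_singleton_eq_self h0C]
      exact isPreconnected_connectedComponentIn
    have h0S := connectedComponentIn_subset _ _ h0C
    rcases hgood with hbdd | ⟨R, hR⟩
    · exfalso
      obtain ⟨M, hM⟩ := hbdd.exists_norm_le
      set ρ : ℝ := (|M| + ‖c‖ + 1)⁻¹
      have hpos : 0 < |M| + ‖c‖ + 1 := by positivity
      have hρ : 0 < ρ := inv_pos.mpr hpos
      have hfar : ∀ y ∈ S, y ≠ 0 → ρ < ‖y‖ := by
        intro y hy hy0
        have h1 := hM _ ((hmem y hy0).mp hy)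
        have h2 : ‖y⁻¹‖ ≤ ‖c + y⁻¹‖ + ‖c‖ := by
          simpa using norm_sub_le (c + y⁻¹) c
        have h3 : ‖y‖⁻¹ < |M| + ‖c‖ + 1 := by
          rw [← norm_inv]; linarith [le_abs_self M]
        exact (inv_lt_comm₀ (norm_pos_iff.mpr hy0) hpos).mp h3
      obtain ⟨y, hy, hyr⟩ := hexists 0 h0S
      have hsub : connectedComponentIn S 0 ⊆ Metric.ball 0 ρ := by
        refine isPreconnected_connectedComponentIn.subset_left_of_subset_union
          Metric.isOpen_ball Metric.isClosed_closedBall.isOpen_compl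
          (disjoint_compl_right_iff_subset.mpr (Metric.ball_subset_closedBall (x := 0) (ε := ρ)))
          ?_ ⟨0, mem_connectedComponentIn h0S, Metric.mem_ball_self hρ⟩
        intro y hy
        rcases eq_or_ne y 0 with rfl | hy0
        · exact Or.inl (Metric.mem_ball_self hρ)
        · right
          have := hfar y (connectedComponentIn_subset _ _ hy) hy0
          simpa using this
      have hy0 : y = 0 := by
        by_contra hy0
        have h1 := hfar y (connectedComponentIn_subset _ _ hy) hy0
        have h2 := hsub hy
        rw [mem_ball_zero_iff] at h2
        linarith
      exact hroot0 (hy0 ▸ hyr)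
    · have hpos : 0 < |R| + ‖c‖ + 1 := by positivity
      refine isPreconnected_connectedComponentIn.diff_zero (ρ := (|R| + ‖c‖ + 1)⁻¹)
        (inv_pos.mpr hpos) ?_
      rw [connectedComponentIn_eq h0C]
      refine (convex_ball _ _).isPreconnected.subset_connectedComponentIn
        (Metric.mem_ball_self (inv_pos.mpr hpos)) fun y hy => ?_
      rcases eq_or_ne y 0 with rfl | hy0
      · exact h0S
      refine (hmem y hy0).mpr (hR _ ?_)
      rw [mem_ball_zero_iff, lt_inv_comm₀ (norm_pos_iff.mpr hy0) hpos, ← norm_inv] at hy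
      have h2 : ‖y⁻¹‖ ≤ ‖c + y⁻¹‖ + ‖c‖ := by
        simpa using norm_sub_le (c + y⁻¹) c
      linarith [le_abs_self R]
  set x := (z - c)⁻¹ with hx
  have hx0 : x ≠ 0 := inv_ne_zero (sub_ne_zero.mpr hzc)
  have hxz : c + x⁻¹ = z := by simp [hx]
  have hxS : x ∈ S := (hmem x hx0).mpr (by rwa [hxz])
  have htransfer : ∀ y ∈ connectedComponentIn S x, y ≠ 0 →
      c + y⁻¹ ∈ connectedComponentIn Λ z := by
    intro y hy hy0
    have hpre := (hpunct x).image (fun y => c + y⁻¹) (continuousOn_const.add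
      (continuousOn_id.inv₀ fun y hy => hy.2))
    refine hpre.subset_connectedComponentIn ⟨x, ⟨mem_connectedComponentIn hxS, hx0⟩, hxz⟩ ?_
      ⟨y, ⟨hy, hy0⟩, rfl⟩
    rintro _ ⟨y, ⟨hy, hy0⟩, rfl⟩
    exact (hmem y hy0).mp (connectedComponentIn_subset _ _ hy)
  have hne0 : ∀ y, (Polynomial.chart N c (d b₀)).IsRoot y → y ≠ 0 := by
    rintro y hy rfl
    exact hroot0 hy
  refine ⟨?_, fun hdvd hsimple => ?_⟩
  · obtain ⟨y, hy, hyr⟩ := hexists x hxS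
    exact ⟨_, htransfer y hy (hne0 y hyr),
      (isRoot_chart_iff hdeg0.le (hne0 y hyr)).mp hyr⟩
  · have h2 : 2 ≤ (Polynomial.chart N c (d b)).roots.count x := by
      rw [count_roots, le_rootMultiplicity_iff (hne b hb)]
      exact sq_dvd_chart (F.natDegree_le b) hzc hdvd
    have h3 := h2.trans (hcount b hb x)
    have hnodup : (Polynomial.chart N c (d b₀)).roots.Nodup := by
      rw [Multiset.nodup_iff_count_le_one]
      intro y
      by_contra! h
      rw [count_roots, Nat.lt_iff_add_one_le, le_rootMultiplicity_iff (hne b₀ hb₀)] at h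
      have hy : (Polynomial.chart N c (d b₀)).IsRoot y :=
        dvd_iff_isRoot.mp ((dvd_pow_self _ two_ne_zero).trans h)
      exact hsimple _ (sq_dvd_of_sq_dvd_chart hdeg0.le (hne0 y hy) h)
    rw [Multiset.countP_eq_card_filter] at h3
    have h4 : 1 < ((Polynomial.chart N c (d b₀)).roots.filter
        (· ∈ connectedComponentIn S x)).toFinset.card := by
      rw [Multiset.toFinset_card_of_nodup (hnodup.filter _)]
      exact h3
    obtain ⟨y, hy, y', hy', hyy⟩ := Finset.one_lt_card.mp h4
    simp only [Multiset.mem_toFinset, Multiset.mem_filter] at hy hy'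
    have hyr := isRoot_of_mem_roots hy.1
    have hyr' := isRoot_of_mem_roots hy'.1
    refine ⟨_, htransfer y hy.2 (hne0 y hyr), _, htransfer y' hy'.2 (hne0 y' hyr'), ?_,
      (isRoot_chart_iff hdeg0.le (hne0 y hyr)).mp hyr,
      (isRoot_chart_iff hdeg0.le (hne0 y' hyr')).mp hyr'⟩
    intro h
    exact hyy (inv_injective (add_left_cancel h))

end ContinuousPolyFamily

/-! ### The determinant polynomial and the set of admissible perturbations. -/

/-- Coefficientwise continuity of a polynomial-valued function. -/
def ContinuousCoeffs {E : Type*} [TopologicalSpace E] (f : E → ℂ[X]) : Prop :=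
  ∀ k, Continuous fun b => (f b).coeff k

namespace ContinuousCoeffs

variable {E : Type*} [TopologicalSpace E] {ι : Type*}

theorem const (p : ℂ[X]) : ContinuousCoeffs fun _ : E => p := fun _ => continuous_const

theorem mul {f g : E → ℂ[X]} (hf : ContinuousCoeffs f) (hg : ContinuousCoeffs g) :
    ContinuousCoeffs fun b => f b * g b := by
  intro k
  simp only [coeff_mul]
  exact continuous_finsetSum _ fun i _ => (hf i.1).mul (hg i.2)

theorem sum {s : Finset ι} {f : ι → E → ℂ[X]} (hf : ∀ i ∈ s, ContinuousCoeffs (f i)) :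
    ContinuousCoeffs fun b => ∑ i ∈ s, f i b := by
  intro k
  simp only [finsetSum_coeff]
  exact continuous_finsetSum _ fun i hi => hf i hi k

theorem prod {s : Finset ι} {f : ι → E → ℂ[X]} (hf : ∀ i ∈ s, ContinuousCoeffs (f i)) :
    ContinuousCoeffs fun b => ∏ i ∈ s, f i b := by
  classical
  induction s using Finset.induction_on with
  | empty => simpa using const 1
  | insert a s ha ih =>
    simp only [Finset.prod_insert ha]
    exact (hf a (Finset.mem_insert_self a s)).mul
      (ih fun i hi => hf i (Finset.mem_insert_of_mem hi))

end ContinuousCoeffs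

namespace MatPoly

variable {n m : ℕ}

/-- The matrix polynomial as a matrix of polynomials. -/
noncomputable def polyMatrix (P : MatPoly n m) : Matrix (Fin n) (Fin n) ℂ[X] :=
  ∑ j : Fin (m + 1), (X ^ (j : ℕ) : ℂ[X]) • (P j).map C

theorem detPoly_eq (P : MatPoly n m) : P.detPoly = P.polyMatrix.det := rfl

theorem polyMatrix_apply (P : MatPoly n m) (a b : Fin n) :
    P.polyMatrix a b = ∑ j : Fin (m + 1), X ^ (j : ℕ) * C (P j a b) := by
  simp [polyMatrix, Matrix.sum_apply]

theorem eval_detPoly (P : MatPoly n m) (z : ℂ) : P.detPoly.eval z = (P.eval z).det := by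
  rw [detPoly_eq, ← coe_evalRingHom, RingHom.map_det]
  congr 1
  ext a b
  simp [polyMatrix_apply, eval, Matrix.sum_apply, eval_finsetSum]
  exact Finset.sum_congr rfl fun j _ => mul_comm _ _

theorem mem_eigenvalues {P : MatPoly n m} {z : ℂ} : z ∈ P.eigenvalues ↔ P.detPoly.IsRoot z := by
  rw [IsRoot, eval_detPoly]
  rfl

theorem natDegree_polyMatrix_apply_le (P : MatPoly n m) (a b : Fin n) :
    (P.polyMatrix a b).natDegree ≤ m := by
  rw [polyMatrix_apply]
  refine natDegree_sum_le_of_forall_le _ _ fun j _ => ?_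
  rw [mul_comm]
  exact (natDegree_C_mul_X_pow_le _ _).trans (Nat.lt_succ_iff.mp j.2)

theorem coeff_polyMatrix_apply (P : MatPoly n m) (a b : Fin n) (k : ℕ) :
    (P.polyMatrix a b).coeff k = ∑ j : Fin (m + 1), if k = j then P j a b else 0 := by
  rw [polyMatrix_apply, finsetSum_coeff]
  refine Finset.sum_congr rfl fun j _ => ?_
  rw [mul_comm, coeff_C_mul_X_pow]

theorem natDegree_detPoly_le (P : MatPoly n m) : P.detPoly.natDegree ≤ n * m := by
  rw [detPoly_eq, Matrix.det_apply']
  refine natDegree_sum_le_of_forall_le _ _ fun σ _ => ?_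
  rw [← C_eq_intCast]
  refine (natDegree_C_mul_le _ _).trans ((natDegree_prod_le _ _).trans ?_)
  refine (Finset.sum_le_sum fun i _ => P.natDegree_polyMatrix_apply_le _ _).trans ?_
  simp

theorem coeff_detPoly (P : MatPoly n m) : P.detPoly.coeff (n * m) = (P (Fin.last m)).det := by
  have hlast : ∀ a b, (P.polyMatrix a b).coeff m = P (Fin.last m) a b := by
    intro a b
    rw [coeff_polyMatrix_apply, Finset.sum_eq_single (Fin.last m)]
    · simp
    · intro j _ hj
      rw [if_neg]
      intro h
      exact hj (Fin.ext h.symm)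
    · simp
  rw [detPoly_eq, Matrix.det_apply', Matrix.det_apply', finsetSum_coeff]
  refine Finset.sum_congr rfl fun σ _ => ?_
  rw [← C_eq_intCast, coeff_C_mul]
  congr 1
  have := coeff_prod_of_natDegree_le Finset.univ (fun i => P.polyMatrix (σ i) i) m
    fun i _ => P.natDegree_polyMatrix_apply_le _ _
  rw [Finset.card_univ, Fintype.card_fin] at this
  rw [this]
  exact Finset.prod_congr rfl fun i _ => hlast _ _

theorem continuousPolyFamily_detPoly :
    ContinuousPolyFamily (fun P : MatPoly n m => P.detPoly) (n * m) where
  continuous_coeff := by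
    have hentry : ∀ a b, ContinuousCoeffs fun P : MatPoly n m => P.polyMatrix a b := by
      intro a b k
      simp only [coeff_polyMatrix_apply]
      refine continuous_finsetSum _ fun j _ => ?_
      split_ifs
      · exact (continuous_apply j).matrix_elem a b
      · exact continuous_const
    simp only [detPoly_eq, Matrix.det_apply']
    exact ContinuousCoeffs.sum fun σ _ => (ContinuousCoeffs.const _).mul
      (ContinuousCoeffs.prod fun i _ => hentry _ _)
  natDegree_le := natDegree_detPoly_le

theorem two_le_algMultiplicity_iff {P : MatPoly n m} {z : ℂ} :
    2 ≤ P.algMultiplicity z ↔ (X - C z) ^ 2 ∣ P.detPoly := by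
  rw [algMultiplicity]
  exact pow_dvd_iff_le_emultiplicity (k := 2).symm

theorem hasMultipleEigenvalue_iff {P : MatPoly n m} :
    P.HasMultipleEigenvalue ↔ ∃ z, (X - C z) ^ 2 ∣ P.detPoly := by
  simp only [HasMultipleEigenvalue, two_le_algMultiplicity_iff]
  refine exists_congr fun z => ⟨fun h => h.2, fun h => ⟨?_, h⟩⟩
  exact mem_eigenvalues.mpr (dvd_iff_isRoot.mp ((dvd_pow_self _ two_ne_zero).trans h))

/-- A multiple root is a common root of the polynomial and its derivative. -/
theorem _root_.Polynomial.sq_dvd_of_isRoot_derivative {p : ℂ[X]} {z : ℂ} (h : p.IsRoot z)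
    (h' : (derivative p).IsRoot z) : (X - C z) ^ 2 ∣ p := by
  rcases eq_or_ne p 0 with rfl | h0
  · simp
  exact (le_rootMultiplicity_iff h0).mp ((one_lt_rootMultiplicity_iff_isRoot h0).mpr ⟨h, h'⟩)

section Perturbations

open scoped Matrix.Norms.L2Operator

variable {P : MatPoly n m} {w : Fin (m + 1) → ℝ} {ε δ : ℝ}

theorem perturbations_eq_pi (P : MatPoly n m) (w : Fin (m + 1) → ℝ) (ε : ℝ) :
    P.perturbations w ε = univ.pi fun j => Metric.closedBall (P j) (ε * w j) := by
  ext Q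
  simp [perturbations, dist_eq_norm]

theorem isCompact_perturbations (P : MatPoly n m) (w : Fin (m + 1) → ℝ) (ε : ℝ) :
    IsCompact (P.perturbations w ε) := by
  have : ProperSpace (Matrix (Fin n) (Fin n) ℂ) := FiniteDimensional.proper ℂ _
  rw [perturbations_eq_pi]
  exact isCompact_univ_pi fun j => isCompact_closedBall _ _

theorem convex_perturbations (P : MatPoly n m) (w : Fin (m + 1) → ℝ) (ε : ℝ) :
    Convex ℝ (P.perturbations w ε) := by
  rw [perturbations_eq_pi]
  exact convex_pi fun j _ => convex_closedBall _ _

theorem perturbations_mono (hw : ∀ j, 0 ≤ w j) (h : δ ≤ ε) :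
    P.perturbations w δ ⊆ P.perturbations w ε :=
  fun _ hQ j => (hQ j).trans (mul_le_mul_of_nonneg_right h (hw j))

theorem self_mem_perturbations (hw : ∀ j, 0 ≤ w j) (h : 0 ≤ ε) : P ∈ P.perturbations w ε := by
  intro j
  simpa using mul_nonneg h (hw j)

theorem perturbations_zero (P : MatPoly n m) (w : Fin (m + 1) → ℝ) :
    P.perturbations w 0 = {P} := by
  ext Q
  simp [perturbations, sub_eq_zero, funext_iff]

/-- With t < 1 close to 1, this approximates a perturbation of level ε > 0 by perturbations of
strictly lower level. -/
theorem add_smul_mem_perturbations {Q : MatPoly n m} (hQ : Q ∈ P.perturbations w ε) {t : ℝ}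
    (ht : 0 ≤ t) : P + t • (Q - P) ∈ P.perturbations w (t * ε) := by
  intro j
  have : (P + t • (Q - P)) j - P j = t • (Q j - P j) := by simp
  rw [this, norm_smul, Real.norm_of_nonneg ht, mul_assoc]
  exact mul_le_mul_of_nonneg_left (hQ j) ht

theorem mem_pseudospectrum {z : ℂ} :
    z ∈ P.pseudospectrum w ε ↔ ∃ Q ∈ P.perturbations w ε, Q.detPoly.IsRoot z :=
  exists_congr fun _ => and_congr_right fun _ => mem_eigenvalues

theorem pseudospectrum_eq (P : MatPoly n m) (w : Fin (m + 1) → ℝ) (ε : ℝ) :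
    P.pseudospectrum w ε = {z | ∃ Q ∈ P.perturbations w ε, Q.detPoly.IsRoot z} :=
  Set.ext fun _ => mem_pseudospectrum

theorem isClosed_pseudospectrum (P : MatPoly n m) (w : Fin (m + 1) → ℝ) (ε : ℝ) :
    IsClosed (P.pseudospectrum w ε) := by
  rw [pseudospectrum_eq]
  exact continuousPolyFamily_detPoly.isClosed_setOf_exists_isRoot (P.isCompact_perturbations w ε)

theorem pseudospectrum_mono (hw : ∀ j, 0 ≤ w j) (h : δ ≤ ε) :
    P.pseudospectrum w δ ⊆ P.pseudospectrum w ε :=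
  fun _ ⟨Q, hQ, hz⟩ => ⟨Q, perturbations_mono hw h hQ, hz⟩

theorem eigenvalues_subset_pseudospectrum (hw : ∀ j, 0 ≤ w j) (h : 0 ≤ ε) :
    P.eigenvalues ⊆ P.pseudospectrum w ε :=
  fun _ hz => ⟨P, self_mem_perturbations hw h, hz⟩

end Perturbations

/-! ### Connectedness of the set of perturbations with a prescribed eigenvalue. -/

section Fiber

open scoped Matrix.Norms.L2Operator InnerProductSpace

local notation "𝓥" => EuclideanSpace ℂ (Fin n)

/-- The operator on Euclidean space given by a value of a matrix polynomial. -/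
noncomputable def evalCLM (P : MatPoly n m) (z : ℂ) : 𝓥 →L[ℂ] 𝓥 :=
  Matrix.toEuclideanCLM (n := Fin n) (𝕜 := ℂ) (P.eval z)

theorem evalCLM_apply (P : MatPoly n m) (z : ℂ) (x : 𝓥) :
    P.evalCLM z x =
      ∑ j : Fin (m + 1), z ^ (j : ℕ) • Matrix.toEuclideanCLM (n := Fin n) (𝕜 := ℂ) (P j) x := by
  simp [evalCLM, eval]

theorem isRoot_detPoly_iff {Q : MatPoly n m} {z : ℂ} :
    Q.detPoly.IsRoot z ↔ ∃ x : 𝓥, x ≠ 0 ∧ Q.evalCLM z x = 0 := by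
  rw [IsRoot, eval_detPoly, ← Matrix.exists_mulVec_eq_zero_iff]
  constructor
  · rintro ⟨v, hv, h⟩
    refine ⟨WithLp.toLp 2 v, by simpa using hv, ?_⟩
    rw [evalCLM, Matrix.toEuclideanCLM_toLp, h]
    simp
  · rintro ⟨x, hx, h⟩
    refine ⟨WithLp.ofLp x, by simpa using hx, ?_⟩
    rw [← Matrix.ofLp_toEuclideanCLM]
    rw [evalCLM] at h
    rw [h]
    simp

/-- The rank one matrix `a b*`. -/
def rankOne (a b : 𝓥) : Matrix (Fin n) (Fin n) ℂ :=
  Matrix.vecMulVec (WithLp.ofLp a) (star (WithLp.ofLp b))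

theorem toEuclideanCLM_rankOne (a b : 𝓥) :
    Matrix.toEuclideanCLM (n := Fin n) (𝕜 := ℂ) (rankOne a b) =
      (innerSL ℂ b).smulRight a := by
  ext x i
  rw [Matrix.ofLp_toEuclideanCLM, rankOne, Matrix.vecMulVec_mulVec]
  simp [PiLp.inner_apply, dotProduct, mul_comm]

theorem norm_rankOne (a b : 𝓥) : ‖rankOne a b‖ = ‖b‖ * ‖a‖ := by
  rw [Matrix.cstar_norm_def, toEuclideanCLM_rankOne, ContinuousLinearMap.norm_smulRight_apply,
    innerSL_apply_norm]

theorem continuous_rankOne : Continuous fun p : 𝓥 × 𝓥 => rankOne p.1 p.2 := by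
  unfold rankOne
  exact Continuous.matrix_vecMulVec (by fun_prop) (by fun_prop)

variable {P : MatPoly n m} {w : Fin (m + 1) → ℝ} {ε : ℝ} {μ : ℂ}

/-- A necessary condition on kernel vectors; `kernelPerturbation` shows that it is also sufficient
when x ≠ 0 and the weighted sum is positive. -/
theorem norm_evalCLM_le {Q : MatPoly n m} (hQ : Q ∈ P.perturbations w ε) {x : 𝓥}
    (hx : Q.evalCLM μ x = 0) :
    ‖P.evalCLM μ x‖ ≤ ε * (∑ j, w j * ‖μ‖ ^ (j : ℕ)) * ‖x‖ := by
  have h : P.evalCLM μ x = -∑ j : Fin (m + 1),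
      μ ^ (j : ℕ) • Matrix.toEuclideanCLM (n := Fin n) (𝕜 := ℂ) (Q j - P j) x := by
    rw [← sub_zero (P.evalCLM μ x), ← hx, evalCLM_apply, evalCLM_apply, ← neg_sub,
      ← Finset.sum_sub_distrib]
    simp [smul_sub]
  rw [h, norm_neg, Finset.mul_sum, Finset.sum_mul]
  refine norm_sum_le_of_le _ fun j _ => ?_
  rw [norm_smul, norm_pow]
  have h1 := ContinuousLinearMap.le_opNorm
    (Matrix.toEuclideanCLM (n := Fin n) (𝕜 := ℂ) (Q j - P j)) x
  rw [← Matrix.cstar_norm_def] at h1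
  calc _ ≤ ‖μ‖ ^ (j : ℕ) * (ε * w j * ‖x‖) := by
        refine mul_le_mul_of_nonneg_left (h1.trans ?_) (by positivity)
        exact mul_le_mul_of_nonneg_right (hQ j) (norm_nonneg _)
    _ = _ := by ring

/-- The perturbation of `P` that is smallest among those having `x` in the kernel of the value at
`μ`; here `c` is the phase of `μ`. -/
noncomputable def kernelPerturbation (P : MatPoly n m) (w : Fin (m + 1) → ℝ) (μ c : ℂ) (x : 𝓥) :
    MatPoly n m := fun j =>
  P j - ((w j / (∑ j, w j * ‖μ‖ ^ (j : ℕ)) : ℝ) * (star c) ^ (j : ℕ) * ((‖x‖ ^ 2)⁻¹ : ℝ) : ℂ) •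
    rankOne (P.evalCLM μ x) x

theorem kernelPerturbation_mem (hw : ∀ j, 0 ≤ w j) (hW : 0 < ∑ j, w j * ‖μ‖ ^ (j : ℕ)) {c : ℂ}
    (hc : ‖c‖ = 1) {x : 𝓥} (hx : x ≠ 0)
    (h : ‖P.evalCLM μ x‖ ≤ ε * (∑ j, w j * ‖μ‖ ^ (j : ℕ)) * ‖x‖) :
    P.kernelPerturbation w μ c x ∈ P.perturbations w ε := by
  intro j
  set W := ∑ j, w j * ‖μ‖ ^ (j : ℕ)
  have hx' : 0 < ‖x‖ := norm_pos_iff.mpr hx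
  have h1 : ‖P.kernelPerturbation w μ c x j - P j‖ =
      w j / W * (‖x‖ ^ 2)⁻¹ * (‖x‖ * ‖P.evalCLM μ x‖) := by
    simp only [kernelPerturbation, sub_sub_cancel_left, norm_neg, norm_smul, norm_rankOne, norm_mul,
      norm_pow, norm_star, hc, one_pow, mul_one, Complex.norm_real]
    rw [Real.norm_of_nonneg (div_nonneg (hw j) hW.le), Real.norm_of_nonneg (by positivity)]
  rw [h1]
  calc _ ≤ w j / W * (‖x‖ ^ 2)⁻¹ * (‖x‖ * (ε * W * ‖x‖)) := by
        have := hw j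
        gcongr
    _ = ε * w j := by field_simp

/-- The phases align the corrections: coefficient j removes the fraction w_j‖μ‖^j / W of P(μ)x, and
these fractions sum to 1. -/
theorem kernelPerturbation_apply (hW : 0 < ∑ j, w j * ‖μ‖ ^ (j : ℕ)) {c : ℂ}
    (hc : ‖c‖ = 1) (hcμ : μ = ‖μ‖ * c) {x : 𝓥} (hx : x ≠ 0) :
    (P.kernelPerturbation w μ c x).evalCLM μ x = 0 := by
  set W := ∑ j, w j * ‖μ‖ ^ (j : ℕ) with hWdef
  have hcc : star c * μ = ‖μ‖ := by
    have : star c * c = 1 := by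
      rw [Complex.star_def, mul_comm, Complex.mul_conj, Complex.normSq_eq_norm_sq, hc]
      simp
    nth_rw 1 [hcμ]
    rw [mul_left_comm, this, mul_one]
  have hxx : (‖x‖ : ℂ) ≠ 0 := by simpa using hx
  have hWc : (W : ℂ) ≠ 0 := by exact_mod_cast hW.ne'
  have hterm : ∀ j : Fin (m + 1),
      μ ^ (j : ℕ) • Matrix.toEuclideanCLM (n := Fin n) (𝕜 := ℂ) (P.kernelPerturbation w μ c x j) x =
      μ ^ (j : ℕ) • Matrix.toEuclideanCLM (n := Fin n) (𝕜 := ℂ) (P j) x -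
        (((w j * ‖μ‖ ^ (j : ℕ) : ℝ) : ℂ) / W) • P.evalCLM μ x := by
    intro j
    rw [kernelPerturbation, map_sub, map_smul, toEuclideanCLM_rankOne,
      sub_apply, smul_sub]
    congr 1
    simp only [smul_apply, ContinuousLinearMap.smulRight_apply, innerSL_apply_apply,
      inner_self_eq_norm_sq_to_K, smul_smul]
    congr 1
    rw [← hWdef]
    have h1 : (star c) ^ (j : ℕ) * μ ^ (j : ℕ) = (‖μ‖ : ℂ) ^ (j : ℕ) := by rw [← mul_pow, hcc]
    push_cast
    rw [← h1]
    simp only [Complex.coe_algebraMap]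
    field_simp
  rw [evalCLM_apply, Finset.sum_congr rfl fun j _ => hterm j, Finset.sum_sub_distrib,
    ← evalCLM_apply, ← Finset.sum_smul, ← Finset.sum_div, ← Complex.ofReal_sum, ← hWdef,
    div_self hWc, one_smul, sub_self]

theorem continuousOn_kernelPerturbation (P : MatPoly n m) (w : Fin (m + 1) → ℝ) (μ c : ℂ) :
    ContinuousOn (P.kernelPerturbation w μ c) {x | x ≠ 0} := by
  refine continuousOn_pi.mpr fun j => ?_
  refine ContinuousOn.sub continuousOn_const (ContinuousOn.fun_smul
    (ContinuousOn.mul continuousOn_const ?_) ?_)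
  · refine Complex.continuous_ofReal.comp_continuousOn ?_
    exact (continuous_norm.pow 2).continuousOn.inv₀ fun x hx => by simpa using hx
  · exact (continuous_rankOne.comp
      ((P.evalCLM μ).continuous.prodMk continuous_id)).continuousOn

theorem convex_kernel (P : MatPoly n m) (w : Fin (m + 1) → ℝ) (ε : ℝ) (μ : ℂ) (x : 𝓥) :
    Convex ℝ {Q | Q ∈ P.perturbations w ε ∧ Q.evalCLM μ x = 0} := by
  refine (P.convex_perturbations w ε).inter ?_
  intro Q hQ Q' hQ' a b _ _ _
  have hlin : (a • Q + b • Q').evalCLM μ x = (a : ℂ) • Q.evalCLM μ x + (b : ℂ) • Q'.evalCLM μ x := by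
    have : ∀ (a : ℝ) (A : Matrix (Fin n) (Fin n) ℂ), a • A = (a : ℂ) • A := fun a A => by
      ext; simp
    simp only [evalCLM_apply, Pi.add_apply, Pi.smul_apply, this, map_add, map_smul,
      add_apply, smul_apply, smul_add,
      Finset.sum_add_distrib, Finset.smul_sum]
    congr 1 <;> exact Finset.sum_congr rfl fun j _ => smul_comm _ _ _
  change (a • Q + b • Q').evalCLM μ x = 0
  rw [hlin, show Q.evalCLM μ x = 0 from hQ, show Q'.evalCLM μ x = 0 from hQ']
  simp

/-- The quadratic form ‖Ax‖² - τ²‖x‖² stays nonpositive on nonnegative combinations once its cross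
term is nonpositive, which replacing y by -y can always arrange. -/
theorem norm_sq_add_le {A : 𝓥 →L[ℂ] 𝓥} {τ : ℝ} {x y : 𝓥}
    (hx : ‖A x‖ ^ 2 ≤ τ ^ 2 * ‖x‖ ^ 2) (hy : ‖A y‖ ^ 2 ≤ τ ^ 2 * ‖y‖ ^ 2)
    (hxy : (⟪A x, A y⟫_ℂ).re ≤ τ ^ 2 * (⟪x, y⟫_ℂ).re) {s t : ℝ} (hs : 0 ≤ s) (ht : 0 ≤ t) :
    ‖A ((s : ℂ) • x + (t : ℂ) • y)‖ ^ 2 ≤ τ ^ 2 * ‖(s : ℂ) • x + (t : ℂ) • y‖ ^ 2 := by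
  have h : ∀ u v : 𝓥, ‖(s : ℂ) • u + (t : ℂ) • v‖ ^ 2 =
      s ^ 2 * ‖u‖ ^ 2 + 2 * (s * t * (⟪u, v⟫_ℂ).re) + t ^ 2 * ‖v‖ ^ 2 := by
    intro u v
    rw [norm_add_sq (𝕜 := ℂ), norm_smul, norm_smul, inner_smul_left, inner_smul_right]
    simp [mul_pow, Complex.conj_ofReal]
    ring
  rw [map_add, map_smul, map_smul, h, h]
  nlinarith [mul_le_mul_of_nonneg_left hx (sq_nonneg s), mul_le_mul_of_nonneg_left hy (sq_nonneg t),
    mul_le_mul_of_nonneg_left hxy (mul_nonneg hs ht)]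

/-- The admissible perturbations with a given eigenvalue form a connected set. -/
theorem isPreconnected_setOf_isRoot (hw : ∀ j, 0 ≤ w j) (hw0 : 0 < w 0) (hε : 0 ≤ ε) (μ : ℂ) :
    IsPreconnected {Q | Q ∈ P.perturbations w ε ∧ Q.detPoly.IsRoot μ} := by
  have hW : 0 < ∑ j, w j * ‖μ‖ ^ (j : ℕ) := by
    refine Finset.sum_pos' (fun j _ => mul_nonneg (hw j) (by positivity)) ⟨0, Finset.mem_univ _, ?_⟩
    simpa using hw0
  set W := ∑ j, w j * ‖μ‖ ^ (j : ℕ) with hWdef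
  have hsub : ∀ x : 𝓥, x ≠ 0 → {Q | Q ∈ P.perturbations w ε ∧ Q.evalCLM μ x = 0} ⊆
      {Q | Q ∈ P.perturbations w ε ∧ Q.detPoly.IsRoot μ} :=
    fun x hx Q hQ => ⟨hQ.1, isRoot_detPoly_iff.mpr ⟨x, hx, hQ.2⟩⟩
  obtain ⟨c, hc, hcμ⟩ : ∃ c : ℂ, ‖c‖ = 1 ∧ μ = ‖μ‖ * c :=
    ⟨Complex.exp (μ.arg * Complex.I), Complex.norm_exp_ofReal_mul_I _,
      (Complex.norm_mul_exp_arg_mul_I μ).symm⟩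
  refine isPreconnected_of_forall_pair fun Q hQ Q' hQ' => ?_
  obtain ⟨x, hx, hQx⟩ := isRoot_detPoly_iff.mp hQ.2
  obtain ⟨y, hy, hQy, hxy⟩ : ∃ y : 𝓥, y ≠ 0 ∧ Q'.evalCLM μ y = 0 ∧
      (⟪P.evalCLM μ x, P.evalCLM μ y⟫_ℂ).re ≤ (ε * W) ^ 2 * (⟪x, y⟫_ℂ).re := by
    obtain ⟨y, hy, hQy⟩ := isRoot_detPoly_iff.mp hQ'.2
    rcases le_total (⟪P.evalCLM μ x, P.evalCLM μ y⟫_ℂ).re ((ε * W) ^ 2 * (⟪x, y⟫_ℂ).re) with h | h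
    · exact ⟨y, hy, hQy, h⟩
    · refine ⟨-y, neg_ne_zero.mpr hy, by rw [map_neg, hQy, neg_zero], ?_⟩
      rw [map_neg, inner_neg_right, inner_neg_right, Complex.neg_re, Complex.neg_re]
      linarith
  -- If the segment hits 0, then x is proportional to y, so it also lies in the kernel of Q'(μ), and
  -- a single convex set contains both perturbations.
  by_cases hdep : ∃ t ∈ Icc (0 : ℝ) 1, (((1 - t : ℝ) : ℂ)) • x + (t : ℂ) • y = 0
  · obtain ⟨t, -, ht⟩ := hdep
    refine ⟨_, hsub x hx, ⟨hQ.1, hQx⟩, ⟨hQ'.1, ?_⟩, (P.convex_kernel w ε μ x).isPreconnected⟩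
    have h1 := congrArg (Q'.evalCLM μ) ht
    rw [map_add, map_smul, map_smul, hQy, smul_zero, add_zero, map_zero, smul_eq_zero] at h1
    refine h1.resolve_left fun h2 => ?_
    have ht1 : t = 1 := by
      have : 1 - t = 0 := by exact_mod_cast h2
      linarith
    rw [ht1] at ht
    simp at ht
    exact hy ht
  push Not at hdep
  have hQmem := norm_evalCLM_le hQ.1 hQx
  have hQmem' := norm_evalCLM_le hQ'.1 hQy
  rw [← hWdef] at hQmem hQmem'
  let γ : ℝ → 𝓥 := fun t => (((1 - t : ℝ) : ℂ)) • x + (t : ℂ) • y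
  have hγ : Continuous γ := by fun_prop
  have hγmem : ∀ t ∈ Icc (0 : ℝ) 1,
      ‖P.evalCLM μ (γ t)‖ ≤ ε * W * ‖γ t‖ := by
    intro t ht
    have h2 : ∀ u : 𝓥, ‖P.evalCLM μ u‖ ≤ ε * W * ‖u‖ →
        ‖P.evalCLM μ u‖ ^ 2 ≤ (ε * W) ^ 2 * ‖u‖ ^ 2 := fun u hu => by
      rw [← mul_pow]
      exact pow_le_pow_left₀ (norm_nonneg _) hu 2
    have h1 := norm_sq_add_le (h2 x hQmem) (h2 y hQmem') hxy (s := 1 - t) (t := t)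
      (by linarith [ht.2]) ht.1
    rw [← mul_pow] at h1
    exact le_of_sq_le_sq h1 (by positivity)
  set Cx := {Q | Q ∈ P.perturbations w ε ∧ Q.evalCLM μ x = 0}
  set Cy := {Q | Q ∈ P.perturbations w ε ∧ Q.evalCLM μ y = 0}
  set path := (fun t => P.kernelPerturbation w μ c (γ t)) '' Icc (0 : ℝ) 1
  have hpath : IsPreconnected path := isPreconnected_Icc.image _
    ((P.continuousOn_kernelPerturbation w μ c).comp hγ.continuousOn fun t ht => hdep t ht)
  have hγ0 : γ 0 = x := by simp [γ]
  have hγ1 : γ 1 = y := by simp [γ]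
  have hker : ∀ t ∈ Icc (0 : ℝ) 1, P.kernelPerturbation w μ c (γ t) ∈ P.perturbations w ε ∧
      (P.kernelPerturbation w μ c (γ t)).evalCLM μ (γ t) = 0 := fun t ht =>
    ⟨kernelPerturbation_mem hw hW hc (hdep t ht) (hγmem t ht),
      kernelPerturbation_apply hW hc hcμ (hdep t ht)⟩
  have hx0 : P.kernelPerturbation w μ c (γ 0) ∈ Cx := by
    have := hker 0 (by simp)
    rwa [hγ0] at this ⊢
  have hy1 : P.kernelPerturbation w μ c (γ 1) ∈ Cy := by
    have := hker 1 (by simp)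
    rwa [hγ1] at this ⊢
  -- Two convex sets of perturbations, joined by the curve of kernel perturbations along the segment
  -- from x to y.
  refine ⟨Cx ∪ path ∪ Cy, ?_, Or.inl (Or.inl ⟨hQ.1, hQx⟩), Or.inr ⟨hQ'.1, hQy⟩, ?_⟩
  · refine union_subset (union_subset (hsub x hx) ?_) (hsub y hy)
    rintro _ ⟨t, ht, rfl⟩
    exact hsub _ (hdep t ht) (hker t ht)
  · refine IsPreconnected.union _ (Or.inr ⟨1, by simp, rfl⟩) hy1 ?_
      (P.convex_kernel w ε μ y).isPreconnected
    exact IsPreconnected.union _ hx0 ⟨0, by simp, rfl⟩ (P.convex_kernel w ε μ x).isPreconnected hpath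

end Fiber

end MatPoly

/-! ### Swept regions, and multiple eigenvalues where components meet. -/

namespace MatPoly

variable {n m : ℕ} {P : MatPoly n m} {w : Fin (m + 1) → ℝ} {ε δ : ℝ}

/-- The region swept out by the component through `a` of the pseudospectra of level below `ε`. -/
def sweep (P : MatPoly n m) (w : Fin (m + 1) → ℝ) (ε : ℝ) (a : ℂ) : Set ℂ :=
  ⋃ δ ∈ Ioo 0 ε, connectedComponentIn (P.pseudospectrum w δ) a

theorem mem_sweep {a z : ℂ} : z ∈ P.sweep w ε a ↔
    ∃ δ, 0 < δ ∧ δ < ε ∧ z ∈ connectedComponentIn (P.pseudospectrum w δ) a := by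
  simp [sweep, and_assoc]

theorem component_mono (hw : ∀ j, 0 ≤ w j) (h : δ ≤ ε) (a : ℂ) :
    connectedComponentIn (P.pseudospectrum w δ) a ⊆
      connectedComponentIn (P.pseudospectrum w ε) a :=
  connectedComponentIn_mono a (pseudospectrum_mono hw h)

/-- A nonempty swept region is a union of connected sets through `a`; its closure is connected and
stays in the closed set Λ_ε. -/
theorem closure_sweep_subset (hw : ∀ j, 0 ≤ w j) {a : ℂ} :
    closure (P.sweep w ε a) ⊆ connectedComponentIn (P.pseudospectrum w ε) a := by
  rcases (P.sweep w ε a).eq_empty_or_nonempty with h | ⟨z, hz⟩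
  · simp [h]
  obtain ⟨δ, hδ, hδε, hzδ⟩ := mem_sweep.mp hz
  have haδ : a ∈ P.pseudospectrum w δ := connectedComponentIn_nonempty_iff.mp ⟨z, hzδ⟩
  have ha : a ∈ P.sweep w ε a := mem_sweep.mpr ⟨δ, hδ, hδε, mem_connectedComponentIn haδ⟩
  have hpre : IsPreconnected (P.sweep w ε a) := by
    refine isPreconnected_of_forall a fun y hy => ?_
    obtain ⟨δ', hδ', hδε', hyδ⟩ := mem_sweep.mp hy
    refine ⟨connectedComponentIn (P.pseudospectrum w δ') a,
      fun u hu => mem_sweep.mpr ⟨δ', hδ', hδε', hu⟩, mem_connectedComponentIn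
      (connectedComponentIn_nonempty_iff.mp ⟨y, hyδ⟩), hyδ, isPreconnected_connectedComponentIn⟩
  refine hpre.closure.subset_connectedComponentIn (subset_closure ha) ?_
  refine closure_minimal (fun y hy => ?_) (P.isClosed_pseudospectrum w ε)
  obtain ⟨δ', -, hδε', hyδ⟩ := mem_sweep.mp hy
  exact pseudospectrum_mono hw hδε'.le (connectedComponentIn_subset _ _ hyδ)

theorem tendsto_add_smul (P Q : MatPoly n m) :
    Tendsto (fun t : ℝ => P + t • (Q - P)) (𝓝[<] 1) (𝓝 Q) := by
  have h : Continuous fun t : ℝ => P + t • (Q - P) := by fun_prop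
  have := h.tendsto 1
  rw [one_smul, add_sub_cancel] at this
  exact this.mono_left nhdsWithin_le_nhds

theorem eventually_add_smul_mem {Q : MatPoly n m} (hQ : Q ∈ P.perturbations w ε) (hε : 0 < ε) :
    ∀ᶠ t : ℝ in 𝓝[<] 1, ∃ δ, 0 < δ ∧ δ < ε ∧ P + t • (Q - P) ∈ P.perturbations w δ := by
  filter_upwards [Ioo_mem_nhdsLT (show (0 : ℝ) < 1 by norm_num)] with t ht
  exact ⟨t * ε, mul_pos ht.1 hε, by nlinarith [ht.2], add_smul_mem_perturbations hQ ht.1.le⟩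

section Coalescence

open scoped Matrix.Norms.L2Operator

/-- The pairs of a perturbation of level less than `ε` and an eigenvalue of it that lies in the
region swept out by the component through `a`. -/
def sweepPairs (P : MatPoly n m) (w : Fin (m + 1) → ℝ) (ε : ℝ) (a : ℂ) : Set (MatPoly n m × ℂ) :=
  {p | (∃ δ, 0 < δ ∧ δ < ε ∧ p.1 ∈ P.perturbations w δ) ∧ p.1.detPoly.IsRoot p.2 ∧
    p.2 ∈ P.sweep w ε a}

theorem closure_sweepPairs_subset (hw : ∀ j, 0 ≤ w j) (a : ℂ) :
    closure (P.sweepPairs w ε a) ⊆ {p | p.1 ∈ P.perturbations w ε ∧ p.1.detPoly.IsRoot p.2} := by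
  refine closure_minimal ?_ ?_
  · rintro p ⟨⟨δ, -, hδ, hp⟩, hroot, -⟩
    exact ⟨perturbations_mono hw hδ.le hp, hroot⟩
  · exact ((P.isCompact_perturbations w ε).isClosed.preimage continuous_fst).inter
      (isClosed_eq continuousPolyFamily_detPoly.continuous_eval continuous_const)

/-- Compactness of the set of perturbations lifts a limit of eigenvalues to a limit of pairs. -/
theorem exists_mem_closure_sweepPairs (hw : ∀ j, 0 ≤ w j) {a μ : ℂ}
    (hμ : μ ∈ closure (P.sweep w ε a)) :
    ∃ Q, (Q, μ) ∈ closure (P.sweepPairs w ε a) := by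
  have : CompactSpace (P.perturbations w ε) :=
    isCompact_iff_compactSpace.mp (P.isCompact_perturbations w ε)
  have hcl : IsClosed {p : P.perturbations w ε × ℂ | (p.1.1, p.2) ∈ closure (P.sweepPairs w ε a)} :=
    isClosed_closure.preimage
      ((continuous_subtype_val.comp continuous_fst).prodMk continuous_snd)
  have himg := isClosedMap_snd_of_compactSpace _ hcl
  have hsub : P.sweep w ε a ⊆ Prod.snd '' {p : P.perturbations w ε × ℂ |
      (p.1.1, p.2) ∈ closure (P.sweepPairs w ε a)} := by
    intro z hz
    obtain ⟨δ, hδ, hδε, hzδ⟩ := mem_sweep.mp hz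
    obtain ⟨Q, hQ, hroot⟩ := mem_pseudospectrum.mp (connectedComponentIn_subset _ _ hzδ)
    exact ⟨(⟨Q, perturbations_mono hw hδε.le hQ⟩, z),
      subset_closure ⟨⟨δ, hδ, hδε, hQ⟩, hroot, hz⟩, rfl⟩
  obtain ⟨p, hp, rfl⟩ := closure_minimal hsub himg hμ
  exact ⟨p.1.1, hp⟩

/-- If `μ` is a simple eigenvalue of `Q₀`, the neighbouring perturbations have a unique eigenvalue
near `μ`, and all or none of these are in the region swept out by a given component. -/
theorem exists_local_eigenvalue (hw : ∀ j, 0 ≤ w j) {Q₀ : MatPoly n m} {μ : ℂ}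
    (hμ : Q₀.detPoly.IsRoot μ) (hsimple : ¬ (X - C μ) ^ 2 ∣ Q₀.detPoly) :
    ∃ U, IsOpen U ∧ Q₀ ∈ U ∧ ∃ g : MatPoly n m → ℂ, ContinuousOn g U ∧
      (∀ Q ∈ U, Q.detPoly.IsRoot (g Q)) ∧ (∀ Q ∈ U, Q.detPoly.IsRoot μ → g Q = μ) ∧
      ∀ a, ∀ Q ∈ U, (Q, μ) ∈ closure (P.sweepPairs w ε a) →
        ∀ Q' ∈ U, (∃ δ, 0 < δ ∧ δ < ε ∧ Q' ∈ P.perturbations w δ) → g Q' ∈ P.sweep w ε a := by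
  obtain ⟨r, hr, ρ, hρ, g, hg, hroot⟩ := continuousPolyFamily_detPoly.exists_continuousOn_isRoot hμ
    fun h => hsimple (sq_dvd_of_isRoot_derivative hμ h)
  refine ⟨Metric.ball Q₀ r, Metric.isOpen_ball, Metric.mem_ball_self hr, g, hg,
    fun Q hQ => (hroot Q hQ).1,
    fun Q hQ h => ((hroot Q hQ).2 μ (Metric.mem_ball_self hρ) h).symm, ?_⟩
  rintro a Q hQ hcl Q' hQ' ⟨δ', hδ', hδε', hQδ'⟩
  obtain ⟨⟨Q₁, z₁⟩, ⟨hQ₁, hz₁⟩, ⟨δ₁, hδ₁, hδε₁, hQδ₁⟩, hroot₁, hsweep⟩ := mem_closure_iff.mp hcl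
    (Metric.ball Q₀ r ×ˢ Metric.ball μ ρ) (Metric.isOpen_ball.prod Metric.isOpen_ball)
    ⟨hQ, Metric.mem_ball_self hρ⟩
  have hz₁g : z₁ = g Q₁ := (hroot Q₁ hQ₁).2 z₁ hz₁ hroot₁
  obtain ⟨δ₂, hδ₂, hδε₂, hzδ₂⟩ := mem_sweep.mp hsweep
  set δ := max δ' (max δ₁ δ₂)
  have h1 : δ' ≤ δ := le_max_left _ _
  have h2 : δ₁ ≤ δ := (le_max_left _ _).trans (le_max_right _ _)
  have h3 : δ₂ ≤ δ := (le_max_right _ _).trans (le_max_right _ _)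
  -- A ball meets the convex set of perturbations in a convex set, whose image under `g` is a
  -- connected part of Λ_δ joining `z₁` to `g Q'`.
  have hpre : IsPreconnected (g '' (Metric.ball Q₀ r ∩ P.perturbations w δ)) :=
    (((convex_ball Q₀ r).inter (P.convex_perturbations w δ)).isPreconnected).image g
      (hg.mono inter_subset_left)
  have hsub : g '' (Metric.ball Q₀ r ∩ P.perturbations w δ) ⊆ P.pseudospectrum w δ := by
    rintro _ ⟨R, ⟨hR, hRδ⟩, rfl⟩
    exact mem_pseudospectrum.mpr ⟨R, hRδ, (hroot R hR).1⟩
  have hmem : z₁ ∈ g '' (Metric.ball Q₀ r ∩ P.perturbations w δ) :=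
    ⟨Q₁, ⟨hQ₁, perturbations_mono hw h2 hQδ₁⟩, hz₁g.symm⟩
  refine mem_sweep.mpr ⟨δ, hδ'.trans_le h1, max_lt hδε' (max_lt hδε₁ hδε₂), ?_⟩
  rw [connectedComponentIn_eq (component_mono hw h3 a hzδ₂)]
  exact hpre.subset_connectedComponentIn hmem hsub
    ⟨Q', ⟨hQ', perturbations_mono hw h1 hQδ'⟩, rfl⟩

/-- If no perturbation has `μ` as a multiple eigenvalue and the region swept out by a component
accumulates at `μ`, then this is seen at every perturbation with the eigenvalue `μ`. -/
theorem mem_closure_sweepPairs (hw : ∀ j, 0 ≤ w j) (hw0 : 0 < w 0) (hε : 0 < ε) {μ : ℂ}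
    (hno : ∀ Q ∈ P.perturbations w ε, ¬ (X - C μ) ^ 2 ∣ Q.detPoly) {a : ℂ}
    (ha : μ ∈ closure (P.sweep w ε a)) {Q : MatPoly n m} (hQ : Q ∈ P.perturbations w ε)
    (hQμ : Q.detPoly.IsRoot μ) : (Q, μ) ∈ closure (P.sweepPairs w ε a) := by
  let S := {Q | Q ∈ P.perturbations w ε ∧ Q.detPoly.IsRoot μ}
  have hSpre : PreconnectedSpace S := isPreconnected_iff_preconnectedSpace.mp
    (isPreconnected_setOf_isRoot hw hw0 hε.le μ)
  have hclosed : IsClosed {Q : S | (Q.1, μ) ∈ closure (P.sweepPairs w ε a)} :=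
    isClosed_closure.preimage (continuous_subtype_val.prodMk continuous_const)
  -- If the property holds at Q₀, all nearby eigenvalues of lower level lie in the region. For a
  -- neighbouring Q in the fibre, the eigenvalues of P + t(Q - P) with t → 1 from below are among
  -- them and tend to μ.
  have hopen : IsOpen {Q : S | (Q.1, μ) ∈ closure (P.sweepPairs w ε a)} := by
    rw [isOpen_iff_mem_nhds]
    rintro ⟨Q₀, hQ₀⟩ hcl
    obtain ⟨U, hU, hQU, g, hg, hroot, hgμ, hsweep⟩ :=
      exists_local_eigenvalue (P := P) (ε := ε) hw hQ₀.2 (hno Q₀ hQ₀.1)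
    refine mem_of_superset ((hU.preimage continuous_subtype_val).mem_nhds hQU) ?_
    rintro ⟨Q, hQε, hQμ⟩ hQ
    have hlim := P.tendsto_add_smul Q
    have hgQ := (hg.continuousAt (hU.mem_nhds hQ)).tendsto.comp hlim
    rw [hgμ Q hQ hQμ] at hgQ
    refine mem_closure_of_tendsto (hlim.prodMk_nhds hgQ) ?_
    filter_upwards [hlim.eventually (hU.mem_nhds hQ), eventually_add_smul_mem hQε hε]
      with t htU htδ
    exact ⟨htδ, hroot _ htU, hsweep a Q₀ hQU hcl _ htU htδ⟩
  obtain ⟨Q₀, hQ₀⟩ := exists_mem_closure_sweepPairs hw ha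
  have hQ₀S : Q₀ ∈ S := by
    have := closure_sweepPairs_subset hw a hQ₀
    exact ⟨this.1, this.2⟩
  have huniv := IsClopen.eq_univ ⟨hclosed, hopen⟩ ⟨⟨Q₀, hQ₀S⟩, hQ₀⟩
  exact huniv.ge (mem_univ ⟨Q, hQ, hQμ⟩)

/-- A point at which two components of the pseudospectrum meet is a multiple eigenvalue of an
admissible perturbation. -/
theorem ComponentsMeetAt.exists_sq_dvd (hw : ∀ j, 0 ≤ w j) (hw0 : 0 < w 0) (hε : 0 < ε) {μ : ℂ}
    (h : P.ComponentsMeetAt w ε μ) :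
    ∃ Q ∈ P.perturbations w ε, (X - C μ) ^ 2 ∣ Q.detPoly := by
  by_contra! hno
  obtain ⟨z₁, z₂, hdiff, h₁, h₂⟩ := h
  obtain ⟨Q₀, hQ₀⟩ := exists_mem_closure_sweepPairs hw h₁
  have hQS := closure_sweepPairs_subset hw z₁ hQ₀
  obtain ⟨U, hU, hQU, g, hg, hroot, hgμ, hsweep⟩ :=
    exists_local_eigenvalue (P := P) (ε := ε) hw hQS.2 (hno Q₀ hQS.1)
  -- A perturbation of lower level near Q₀ has its local eigenvalue in both regions, so `z₁` and
  -- `z₂` share a component below ε.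
  obtain ⟨t, htU, htδ⟩ := (((P.tendsto_add_smul Q₀).eventually (hU.mem_nhds hQU)).and
    (eventually_add_smul_mem hQS.1 hε)).exists
  obtain ⟨δ₁, hδ₁, hδε₁, hg₁⟩ := mem_sweep.mp (hsweep z₁ Q₀ hQU hQ₀ _ htU htδ)
  obtain ⟨δ₂, hδ₂, hδε₂, hg₂⟩ := mem_sweep.mp (hsweep z₂ Q₀ hQU (mem_closure_sweepPairs hw hw0 hε hno h₂ hQS.1 hQS.2) _ htU htδ)
  refine hdiff (max δ₁ δ₂) (hδ₁.trans_le (le_max_left _ _)) (max_lt hδε₁ hδε₂) ?_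
  have hg₁' := component_mono hw (le_max_left δ₁ δ₂) z₁ hg₁
  have hg₂' := component_mono hw (le_max_right δ₁ δ₂) z₂ hg₂
  rw [connectedComponentIn_eq hg₁', ← connectedComponentIn_eq hg₂']
  exact mem_connectedComponentIn (connectedComponentIn_nonempty_iff.mp ⟨_, hg₂'⟩)

end Coalescence

/-! ### Distribution of the eigenvalues among the components. -/

/-- Each component of the pseudospectrum contains an eigenvalue of `P`. -/
def ComponentsContainEigenvalue (P : MatPoly n m) (w : Fin (m + 1) → ℝ) (ε : ℝ) : Prop :=
  ∀ z ∈ P.pseudospectrum w ε, ∃ a ∈ P.eigenvalues, a ∈ connectedComponentIn (P.pseudospectrum w ε) z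

/-- The eigenvalues of `P` are in different components of the pseudospectrum. -/
def SeparatesEigenvalues (P : MatPoly n m) (w : Fin (m + 1) → ℝ) (ε : ℝ) : Prop :=
  ∀ a ∈ P.eigenvalues, ∀ a' ∈ P.eigenvalues,
    a' ∈ connectedComponentIn (P.pseudospectrum w ε) a → a' = a

theorem SeparatesEigenvalues.mono (hw : ∀ j, 0 ≤ w j) (h : P.SeparatesEigenvalues w ε)
    (hδ : δ ≤ ε) : P.SeparatesEigenvalues w δ :=
  fun a ha a' ha' h' => h a ha a' ha' (component_mono hw hδ a h')

theorem mem_component_symm {S : Set ℂ} {a b : ℂ} (h : b ∈ connectedComponentIn S a) :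
    a ∈ connectedComponentIn S b := by
  rw [← connectedComponentIn_eq h]
  exact mem_connectedComponentIn (connectedComponentIn_nonempty_iff.mp ⟨b, h⟩)

/-- If the components at levels arbitrarily close to `ε` contain eigenvalues, then the regions swept
out by the components through the eigenvalues fill the pseudospectrum at level `ε`. -/
theorem exists_mem_closure_sweep (hw : ∀ j, 0 ≤ w j) (hε : 0 < ε) (hfin : P.eigenvalues.Finite)
    (hE : ∀ δ, 0 < δ → δ < ε → ∃ δ', δ ≤ δ' ∧ δ' < ε ∧ P.ComponentsContainEigenvalue w δ')
    (hne : ∀ Q ∈ P.perturbations w ε, Q.detPoly ≠ 0) {z : ℂ} (hz : z ∈ P.pseudospectrum w ε) :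
    ∃ a ∈ P.eigenvalues, z ∈ closure (P.sweep w ε a) := by
  suffices h : z ∈ closure (⋃ a ∈ P.eigenvalues, P.sweep w ε a) by
    rw [hfin.closure_biUnion] at h
    simpa using h
  obtain ⟨Q, hQ, hroot⟩ := mem_pseudospectrum.mp hz
  rw [Metric.mem_closure_iff]
  intro ρ hρ
  -- Shrinking Q towards P gives, by Hurwitz, a point of a lower pseudospectrum close to z.
  obtain ⟨t, ⟨δ, hδ, hδε, htδ⟩, x, hx, hxroot⟩ := ((eventually_add_smul_mem hQ hε).and
    ((P.tendsto_add_smul Q).eventually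
      (continuousPolyFamily_detPoly.eventually_exists_isRoot (hne Q hQ) hroot hρ))).exists
  obtain ⟨δ', hδ', hδε', hE'⟩ := hE δ hδ hδε
  obtain ⟨a, ha, hax⟩ := hE' x
    (pseudospectrum_mono hw hδ' (mem_pseudospectrum.mpr ⟨_, htδ, hxroot⟩))
  refine ⟨x, ?_, by rwa [dist_comm]⟩
  simp only [mem_iUnion]
  exact ⟨a, ha, mem_sweep.mpr ⟨δ', hδ.trans_le hδ', hδε', mem_component_symm hax⟩⟩

/-- At the first level at which two eigenvalues share a component, two components meet. -/
theorem exists_componentsMeetAt (hw : ∀ j, 0 ≤ w j) (hε : 0 < ε) (hfin : P.eigenvalues.Finite)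
    (hcover : ∀ z ∈ P.pseudospectrum w ε, ∃ a ∈ P.eigenvalues, z ∈ closure (P.sweep w ε a))
    (hsep : ∀ δ, 0 < δ → δ < ε → P.SeparatesEigenvalues w δ)
    (hnot : ¬ P.SeparatesEigenvalues w ε) : ∃ μ, P.ComponentsMeetAt w ε μ := by
  unfold SeparatesEigenvalues at hnot
  push Not at hnot
  obtain ⟨a, ha, a', ha', hcomp, hne⟩ := hnot
  have hself : ∀ b ∈ P.eigenvalues, b ∈ closure (P.sweep w ε b) := fun b hb =>
    subset_closure (mem_sweep.mpr ⟨ε / 2, by linarith, by linarith, mem_connectedComponentIn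
      (eigenvalues_subset_pseudospectrum hw (by linarith) hb)⟩)
  -- The closed region of `a` and the finite union of the other closed regions cover a connected set
  -- and both meet it, so they share a point.
  obtain ⟨μ, -, h₁, h₂⟩ := isPreconnected_closed_iff.mp
    (isPreconnected_connectedComponentIn (x := a) (F := P.pseudospectrum w ε))
    (closure (P.sweep w ε a)) (⋃ b ∈ P.eigenvalues \ {a}, closure (P.sweep w ε b)) isClosed_closure
    (hfin.sdiff.isClosed_biUnion fun _ _ => isClosed_closure) (by
      intro z hz
      obtain ⟨b, hb, hzb⟩ := hcover z (connectedComponentIn_subset _ _ hz)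
      by_cases hba : b = a
      · exact Or.inl (hba ▸ hzb)
      · exact Or.inr (mem_biUnion (show b ∈ P.eigenvalues \ {a} from ⟨hb, hba⟩) hzb))
    ⟨a, mem_connectedComponentIn (eigenvalues_subset_pseudospectrum hw hε.le ha), hself a ha⟩
    ⟨a', hcomp, mem_biUnion (show a' ∈ P.eigenvalues \ {a} from ⟨ha', hne⟩) (hself a' ha')⟩
  obtain ⟨b, ⟨hb, hba⟩, hμb⟩ := mem_iUnion₂.mp h₂
  exact ⟨μ, a, b, fun δ hδ hδε h => hba (hsep δ hδ hδε a ha b hb h), h₁, hμb⟩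

/-! ### Dependence on the level, and behaviour near infinity. -/

section Bounded

open scoped Matrix.Norms.L2Operator

/-- Upper semicontinuity of the pseudospectrum. -/
theorem eventually_pseudospectrum_subset (hw : ∀ j, 0 ≤ w j) {ε₁ : ℝ} (hε : ε < ε₁)
    (hbdd : Bornology.IsBounded (P.pseudospectrum w ε₁)) {O : Set ℂ} (hO : IsOpen O)
    (h : P.pseudospectrum w ε ⊆ O) : ∀ᶠ δ in 𝓝[>] ε, P.pseudospectrum w δ ⊆ O := by
  -- Triples of a level, a perturbation and an eigenvalue outside `O`. The set is compact, so the
  -- levels occurring in it form a closed set, which misses ε.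
  set Z : Set (ℝ × MatPoly n m × ℂ) :=
    (Icc ε ε₁ ×ˢ P.perturbations w ε₁ ×ˢ (P.pseudospectrum w ε₁ \ O)) ∩
      {p | p.2.1 ∈ P.perturbations w p.1 ∧ p.2.1.detPoly.IsRoot p.2.2}
  have hZ : IsCompact Z := by
    refine IsCompact.inter_right (isCompact_Icc.prod ((P.isCompact_perturbations w ε₁).prod
      ((Metric.isCompact_of_isClosed_isBounded (P.isClosed_pseudospectrum w ε₁) hbdd).diff hO))) ?_
    refine IsClosed.inter ?_ (isClosed_eq
      (continuousPolyFamily_detPoly.continuous_eval.comp continuous_snd) continuous_const)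
    have : {p : ℝ × MatPoly n m × ℂ | p.2.1 ∈ P.perturbations w p.1} =
        ⋂ j, {p : ℝ × MatPoly n m × ℂ | ‖p.2.1 j - P j‖ ≤ p.1 * w j} := by
      ext p
      simp [perturbations]
    change IsClosed {p : ℝ × MatPoly n m × ℂ | p.2.1 ∈ P.perturbations w p.1}
    rw [this]
    refine isClosed_iInter fun j => isClosed_le ?_ (continuous_fst.mul continuous_const)
    exact (((continuous_apply j).comp (continuous_fst.comp continuous_snd)).sub
      continuous_const).norm
  have hnot : ε ∉ Prod.fst '' Z := by
    rintro ⟨⟨_, Q, z⟩, ⟨⟨-, -, -, hzO⟩, hQ, hroot⟩, rfl⟩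
    exact hzO (h (mem_pseudospectrum.mpr ⟨Q, hQ, hroot⟩))
  have hev : ∀ᶠ δ in 𝓝[>] ε, δ ∉ Prod.fst '' Z := nhdsWithin_le_nhds
    ((hZ.image continuous_fst).isClosed.isOpen_compl.mem_nhds hnot)
  filter_upwards [hev, Ioo_mem_nhdsGT hε] with δ hδ hδε z hz
  by_contra hzO
  obtain ⟨Q, hQ, hroot⟩ := mem_pseudospectrum.mp hz
  exact hδ ⟨(δ, Q, z), ⟨⟨⟨hδε.1.le, hδε.2.le⟩, perturbations_mono hw hδε.2.le hQ,
    pseudospectrum_mono hw hδε.2.le hz, hzO⟩, hQ, hroot⟩, rfl⟩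

/-- A clopen splitting of Λ_ε has disjoint open neighbourhoods, which by upper semicontinuity still
cover Λ_δ for δ slightly above ε. Hence a first level without separation is attained. -/
theorem SeparatesEigenvalues.exists_gt (hw : ∀ j, 0 ≤ w j) (hε : 0 ≤ ε) {ε₁ : ℝ} (hε₁ : ε < ε₁)
    (hbdd : Bornology.IsBounded (P.pseudospectrum w ε₁)) (hfin : P.eigenvalues.Finite)
    (h : P.SeparatesEigenvalues w ε) : ∃ δ > ε, P.SeparatesEigenvalues w δ := by
  have hcompact : IsCompact (P.pseudospectrum w ε) :=
    Metric.isCompact_of_isClosed_isBounded (P.isClosed_pseudospectrum w ε)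
      (hbdd.subset (pseudospectrum_mono hw hε₁.le))
  have hmem := eigenvalues_subset_pseudospectrum (P := P) hw hε
  have hev : ∀ a ∈ P.eigenvalues, ∀ᶠ δ in 𝓝[>] ε, ∀ a' ∈ P.eigenvalues,
      a' ∈ connectedComponentIn (P.pseudospectrum w δ) a → a' = a := by
    intro a ha
    obtain ⟨K, K', hK, hK', hKK, hunion, haK, hT⟩ :=
      hcompact.exists_isCompact_separation (hmem ha) hfin.toFinset
    obtain ⟨U, V, hU, hV, hKU, hKV, hUV⟩ := SeparatedNhds.of_isCompact_isCompact hK hK' hKK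
    filter_upwards [eventually_pseudospectrum_subset hw hε₁ hbdd (hU.union hV)
      (by rw [← hunion]; exact union_subset_union hKU hKV), self_mem_nhdsWithin] with δ hδ hδε
    intro a' ha' hcomp
    have haδ : a ∈ P.pseudospectrum w δ := pseudospectrum_mono hw (le_of_lt hδε) (hmem ha)
    have hsub := (isPreconnected_connectedComponentIn (x := a)
      (F := P.pseudospectrum w δ)).subset_left_of_subset_union hU hV hUV
      ((connectedComponentIn_subset _ _).trans hδ)
      ⟨a, mem_connectedComponentIn haδ, hKU (haK (mem_connectedComponentIn (hmem ha)))⟩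
    rcases hunion.ge (hmem ha') with h1 | h1
    · exact h a ha a' ha' (hT a' (hfin.mem_toFinset.mpr ha') h1)
    · exact (hUV.le_bot ⟨hsub hcomp, hKV h1⟩).elim
  obtain ⟨δ, hδ, hδε⟩ := ((hfin.eventually_all.mpr hev).and self_mem_nhdsWithin).exists
  exact ⟨δ, hδε, hδ⟩

theorem separatesEigenvalues_zero (w : Fin (m + 1) → ℝ) (hfin : P.eigenvalues.Finite) :
    P.SeparatesEigenvalues w 0 := by
  intro a ha a' _ h
  have hS : P.pseudospectrum w 0 = P.eigenvalues := by
    ext z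
    simp [pseudospectrum, perturbations_zero]
  rw [hS] at h
  have := (hfin.countable.mono (connectedComponentIn_subset _ a)).isTotallyDisconnected
  exact this _ subset_rfl isPreconnected_connectedComponentIn h (mem_connectedComponentIn ha)

theorem exists_isBounded_pseudospectrum (hw : ∀ j, 0 ≤ w j) (hw0 : 0 < w 0)
    (hlead : (P (Fin.last m)).det ≠ 0) :
    ∃ ε > 0, Bornology.IsBounded (P.pseudospectrum w ε) := by
  have hO : IsOpen {Q : MatPoly n m | (Q (Fin.last m)).det ≠ 0} :=
    isOpen_ne_fun (continuous_apply _).matrix_det continuous_const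
  obtain ⟨r, hr, hball⟩ := Metric.isOpen_iff.mp hO P hlead
  have hW : 0 < ∑ j, w j := Finset.sum_pos' (fun j _ => hw j) ⟨0, Finset.mem_univ _, hw0⟩
  -- This level makes every ε w_j at most r/2, within the radius on which the leading determinant
  -- stays nonzero.
  refine ⟨r / 2 / ∑ j, w j, by positivity, ?_⟩
  rw [pseudospectrum_eq]
  refine (continuousPolyFamily_detPoly.isCompact_setOf_exists_isRoot
    (P.isCompact_perturbations w _) fun Q hQ => ?_).isBounded
  rw [coeff_detPoly]
  refine hball ?_
  rw [Metric.mem_ball]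
  refine lt_of_le_of_lt ((dist_pi_le_iff (by positivity)).mpr fun j => ?_) (half_lt_self hr)
  rw [dist_eq_norm]
  refine (hQ j).trans ?_
  rw [div_mul_eq_mul_div, div_le_iff₀ hW]
  exact mul_le_mul_of_nonneg_left
    (Finset.single_le_sum (fun i _ => hw i) (Finset.mem_univ j)) (by positivity)

/-- Above a level at which the pseudospectrum is unbounded it contains a neighbourhood of
infinity. -/
theorem exists_forall_mem_of_not_isBounded (hw : ∀ j, 0 ≤ w j) (hlead : (P (Fin.last m)).det ≠ 0)
    (h : ¬ Bornology.IsBounded (P.pseudospectrum w δ)) (hδ : δ < ε) :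
    ∃ R : ℝ, ∀ z, R < ‖z‖ → z ∈ P.pseudospectrum w ε := by
  -- Some Q of level δ has Q_m x = 0 with x ≠ 0. Then Q(z)x = o(z^m), so for large z a rank one
  -- change of Q_m within the spare amount (ε - δ)w_m puts x in the kernel of the value at z.
  obtain ⟨Q, hQ, hdet⟩ : ∃ Q ∈ P.perturbations w δ, (Q (Fin.last m)).det = 0 := by
    by_contra! hall
    refine h ?_
    rw [pseudospectrum_eq]
    exact (continuousPolyFamily_detPoly.isCompact_setOf_exists_isRoot
      (P.isCompact_perturbations w _) fun Q hQ => by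
        rw [coeff_detPoly]; exact hall Q hQ).isBounded
  have hwm : 0 < w (Fin.last m) := by
    refine (hw _).lt_of_ne fun h0 => ?_
    have h1 := hQ (Fin.last m)
    rw [← h0, mul_zero, norm_le_zero_iff, sub_eq_zero] at h1
    exact hlead (h1 ▸ hdet)
  obtain ⟨v, hv, hQv⟩ := Matrix.exists_mulVec_eq_zero_iff.mpr hdet
  set x : EuclideanSpace ℂ (Fin n) := WithLp.toLp 2 v with hxdef
  have hx : x ≠ 0 := by simpa [x] using hv
  have hQx : Matrix.toEuclideanCLM (n := Fin n) (𝕜 := ℂ) (Q (Fin.last m)) x = 0 := by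
    rw [hxdef, Matrix.toEuclideanCLM_toLp, hQv]
    simp
  have hx0 : 0 < ‖x‖ := norm_pos_iff.mpr hx
  have hlim : Tendsto (fun z : ℂ => (z ^ m)⁻¹ • Q.evalCLM z x) (Bornology.cobounded ℂ) (𝓝 0) := by
    have hterm : ∀ j : Fin (m + 1), Tendsto (fun z : ℂ => (z ^ m)⁻¹ • z ^ (j : ℕ) •
        Matrix.toEuclideanCLM (n := Fin n) (𝕜 := ℂ) (Q j) x) (Bornology.cobounded ℂ) (𝓝 0) := by
      intro j
      rcases eq_or_ne j (Fin.last m) with rfl | hj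
      · simp [hQx]
      have hjm : (j : ℕ) < m := Fin.val_lt_last hj
      have h1 : Tendsto (fun z : ℂ => z⁻¹ ^ (m - j)) (Bornology.cobounded ℂ) (𝓝 0) := by
        have := (tendsto_inv₀_cobounded (α := ℂ)).pow (m - j)
        rwa [zero_pow (by lia)] at this
      have h2 := h1.smul_const (Matrix.toEuclideanCLM (n := Fin n) (𝕜 := ℂ) (Q j) x)
      rw [zero_smul] at h2
      refine h2.congr' ?_
      filter_upwards [Bornology.eventually_ne_cobounded (0 : ℂ)] with z hz
      rw [smul_smul]
      congr 1
      rw [inv_pow, eq_comm, inv_mul_eq_iff_eq_mul₀ (pow_ne_zero _ hz), eq_mul_inv_iff_mul_eq₀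
        (pow_ne_zero _ hz), ← pow_add]
      congr 1
      lia
    have := tendsto_finsetSum Finset.univ fun j _ => hterm j
    simpa only [evalCLM_apply, Finset.smul_sum, Finset.sum_const_zero] using this
  have hsmall : ∀ᶠ z in Bornology.cobounded ℂ,
      ‖(z ^ m)⁻¹ • Q.evalCLM z x‖ < (ε - δ) * w (Fin.last m) * ‖x‖ := by
    have := hlim.norm
    rw [norm_zero] at this
    exact this.eventually (gt_mem_nhds (mul_pos (mul_pos (sub_pos.mpr hδ) hwm) hx0))
  have hmem : ∀ᶠ z in Bornology.cobounded ℂ, z ∈ P.pseudospectrum w ε := by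
    filter_upwards [hsmall, Bornology.eventually_ne_cobounded (0 : ℂ)] with z hz hz0
    set y := (z ^ m)⁻¹ • Q.evalCLM z x
    set A := rankOne ((((‖x‖ ^ 2)⁻¹ : ℝ) : ℂ) • y) x
    have hA : ‖A‖ ≤ (ε - δ) * w (Fin.last m) := by
      rw [norm_rankOne, norm_smul, Complex.norm_real, Real.norm_of_nonneg (by positivity)]
      calc ‖x‖ * ((‖x‖ ^ 2)⁻¹ * ‖y‖) = ‖y‖ / ‖x‖ := by field_simp
        _ ≤ _ := by rw [div_le_iff₀ hx0]; exact hz.le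
    have hAx : z ^ m • Matrix.toEuclideanCLM (n := Fin n) (𝕜 := ℂ) A x = Q.evalCLM z x := by
      rw [toEuclideanCLM_rankOne]
      simp only [ContinuousLinearMap.smulRight_apply, innerSL_apply_apply,
        inner_self_eq_norm_sq_to_K, smul_smul, y]
      nth_rw 2 [← one_smul ℂ (Q.evalCLM z x)]
      congr 1
      have : (‖x‖ : ℂ) ≠ 0 := by exact_mod_cast hx0.ne'
      push_cast
      simp only [Complex.coe_algebraMap]
      field_simp
    refine mem_pseudospectrum.mpr ⟨Q - Pi.single (Fin.last m) A, fun j => ?_,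
      isRoot_detPoly_iff.mpr ⟨x, hx, ?_⟩⟩
    · rcases eq_or_ne j (Fin.last m) with rfl | hj
      · rw [Pi.sub_apply, Pi.single_eq_same, sub_right_comm]
        refine (norm_sub_le _ _).trans ((add_le_add (hQ _) hA).trans (le_of_eq ?_))
        ring
      · rw [Pi.sub_apply, Pi.single_eq_of_ne hj, sub_zero]
        exact perturbations_mono hw hδ.le hQ j
    · have hterm : ∀ j : Fin (m + 1), z ^ (j : ℕ) • Matrix.toEuclideanCLM (n := Fin n) (𝕜 := ℂ)
          ((Q - Pi.single (Fin.last m) A : MatPoly n m) j) x =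
          z ^ (j : ℕ) • Matrix.toEuclideanCLM (n := Fin n) (𝕜 := ℂ) (Q j) x -
            if j = Fin.last m then Q.evalCLM z x else 0 := by
        intro j
        rcases eq_or_ne j (Fin.last m) with rfl | hj
        · rw [Pi.sub_apply, Pi.single_eq_same, map_sub, sub_apply, smul_sub, if_pos rfl, ← hAx]
          simp
        · rw [Pi.sub_apply, Pi.single_eq_of_ne hj, sub_zero, if_neg hj, sub_zero]
      rw [evalCLM_apply, Finset.sum_congr rfl fun j _ => hterm j, Finset.sum_sub_distrib,
        ← evalCLM_apply]
      simp
  obtain ⟨R, -, hR⟩ := (hasBasis_cobounded_norm (E := ℂ)).eventually_iff.mp hmem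
  exact ⟨R, fun z hz => hR (le_of_lt hz)⟩

end Bounded

end MatPoly

/-! ### Counting components and identifying the critical level. -/

namespace MatPoly

variable {n m : ℕ} {P : MatPoly n m} {w : Fin (m + 1) → ℝ} {ε δ : ℝ}

theorem detPoly_ne_zero (hlead : (P (Fin.last m)).det ≠ 0) : P.detPoly ≠ 0 := by
  intro h
  rw [← coeff_detPoly, h, coeff_zero] at hlead
  exact hlead rfl

theorem eigenvalues_eq_roots (hlead : (P (Fin.last m)).det ≠ 0) :
    P.eigenvalues = {z | z ∈ P.detPoly.roots} := by
  ext z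
  rw [mem_eigenvalues]
  exact (mem_roots (detPoly_ne_zero hlead)).symm

theorem finite_eigenvalues (hlead : (P (Fin.last m)).det ≠ 0) : P.eigenvalues.Finite := by
  classical
  rw [eigenvalues_eq_roots hlead]
  exact P.detPoly.roots.finite_toSet

theorem not_sq_dvd_detPoly (hsimple : ∀ z ∈ P.eigenvalues, P.algMultiplicity z = 1) (z : ℂ) :
    ¬ (X - C z) ^ 2 ∣ P.detPoly := by
  intro h
  have hz : z ∈ P.eigenvalues :=
    mem_eigenvalues.mpr (dvd_iff_isRoot.mp ((dvd_pow_self _ two_ne_zero).trans h))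
  have h2 := two_le_algMultiplicity_iff.mpr h
  rw [hsimple z hz] at h2
  exact absurd h2 (by decide)

theorem ncard_eigenvalues (hlead : (P (Fin.last m)).det ≠ 0)
    (hsimple : ∀ z ∈ P.eigenvalues, P.algMultiplicity z = 1) : P.eigenvalues.ncard = n * m := by
  classical
  have h0 := detPoly_ne_zero hlead
  have hdeg : P.detPoly.natDegree = n * m :=
    le_antisymm P.natDegree_detPoly_le (le_natDegree_of_ne_zero (by rwa [coeff_detPoly]))
  have hnodup : P.detPoly.roots.Nodup := by
    rw [Multiset.nodup_iff_count_le_one]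
    intro z
    by_contra! h
    rw [count_roots, Nat.lt_iff_add_one_le, le_rootMultiplicity_iff h0] at h
    exact not_sq_dvd_detPoly hsimple z h
  have hset : P.eigenvalues = P.detPoly.roots.toFinset := by
    rw [eigenvalues_eq_roots hlead]
    ext z
    simp
  rw [hset, Set.ncard_coe_finset, Multiset.toFinset_card_of_nodup hnodup,
    ← (IsAlgClosed.splits P.detPoly).natDegree_eq_card_roots, hdeg]

theorem connectedComponents_mk_eq_iff {S : Set ℂ} {x y : S} :
    (ConnectedComponents.mk x = ConnectedComponents.mk y) ↔
      (y : ℂ) ∈ connectedComponentIn S (x : ℂ) := by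
  rw [connectedComponentIn_eq_image x.2, Subtype.val_injective.mem_set_image]
  exact eq_comm.trans ConnectedComponents.coe_eq_coe'

/-- The map from the eigenvalues to the components of the pseudospectrum. -/
noncomputable def eigenvalueComponent (hw : ∀ j, 0 ≤ w j) (hε : 0 ≤ ε) (a : P.eigenvalues) :
    ConnectedComponents (P.pseudospectrum w ε) :=
  ConnectedComponents.mk ⟨a, eigenvalues_subset_pseudospectrum hw hε a.2⟩

theorem enatCard_eigenvalues (hlead : (P (Fin.last m)).det ≠ 0)
    (hsimple : ∀ z ∈ P.eigenvalues, P.algMultiplicity z = 1) :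
    ENat.card P.eigenvalues = ((n * m : ℕ) : ℕ∞) := by
  have := (finite_eigenvalues hlead).to_subtype
  rw [ENat.card_eq_coe_natCard, Nat.card_coe_set_eq, ncard_eigenvalues hlead hsimple]

theorem SeparatesEigenvalues.le_numComponents (h : P.SeparatesEigenvalues w ε) (hw : ∀ j, 0 ≤ w j)
    (hlead : (P (Fin.last m)).det ≠ 0)
    (hsimple : ∀ z ∈ P.eigenvalues, P.algMultiplicity z = 1) (hε : 0 ≤ ε) :
    ((n * m : ℕ) : ℕ∞) ≤ P.numComponents w ε := by
  rw [← enatCard_eigenvalues hlead hsimple]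
  refine ENat.card_le_card_of_injective (f := eigenvalueComponent (P := P) hw hε) ?_
  intro a b hab
  exact Subtype.ext (h a a.2 b b.2 (connectedComponents_mk_eq_iff.mp hab)).symm

/-- Eigenvalues map onto components; with equally many components this surjection would be
injective, which is separation. -/
theorem ComponentsContainEigenvalue.numComponents_lt (h : P.ComponentsContainEigenvalue w ε)
    (hw : ∀ j, 0 ≤ w j) (hlead : (P (Fin.last m)).det ≠ 0)
    (hsimple : ∀ z ∈ P.eigenvalues, P.algMultiplicity z = 1) (hε : 0 ≤ ε)
    (hnot : ¬ P.SeparatesEigenvalues w ε) :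
    P.numComponents w ε < ((n * m : ℕ) : ℕ∞) := by
  have := (finite_eigenvalues hlead).to_subtype
  have hsurj : Function.Surjective (eigenvalueComponent (P := P) hw hε) := by
    intro c
    obtain ⟨⟨z, hz⟩, rfl⟩ := ConnectedComponents.surjective_coe c
    obtain ⟨a, ha, haz⟩ := h z hz
    exact ⟨⟨a, ha⟩, connectedComponents_mk_eq_iff.mpr (mem_component_symm haz)⟩
  have hfin : Finite (ConnectedComponents (P.pseudospectrum w ε)) := Finite.of_surjective _ hsurj
  rw [← enatCard_eigenvalues hlead hsimple, numComponents, ENat.card_eq_coe_natCard,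
    ENat.card_eq_coe_natCard, Nat.cast_lt]
  refine (Nat.card_le_card_of_surjective _ hsurj).lt_of_ne fun hcard => hnot ?_
  have hbij := (Nat.bijective_iff_surjective_and_card _).mpr ⟨hsurj, hcard.symm⟩
  intro a ha a' ha' hcomp
  have := hbij.1 (a₁ := ⟨a, ha⟩) (a₂ := ⟨a', ha'⟩) (connectedComponents_mk_eq_iff.mpr hcomp)
  exact (congrArg Subtype.val this).symm

/-- If the pseudospectrum is not the plane, and is bounded or contains a neighbourhood of infinity,
then each component contains an eigenvalue, and a multiple eigenvalue of a perturbation forces two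
eigenvalues into one component. -/
theorem componentsContainEigenvalue_and (hw : ∀ j, 0 ≤ w j) (hε : 0 ≤ ε)
    (hlead : (P (Fin.last m)).det ≠ 0) (hsimple : ∀ z ∈ P.eigenvalues, P.algMultiplicity z = 1)
    (huniv : P.pseudospectrum w ε ≠ univ)
    (hgood : Bornology.IsBounded (P.pseudospectrum w ε) ∨
      ∃ R : ℝ, ∀ z, R < ‖z‖ → z ∈ P.pseudospectrum w ε) :
    P.ComponentsContainEigenvalue w ε ∧
      ((∃ Q ∈ P.perturbations w ε, Q.HasMultipleEigenvalue) → ¬ P.SeparatesEigenvalues w ε) := by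
  have key := fun (Q : MatPoly n m) (hQ : Q ∈ P.perturbations w ε) (z : ℂ)
      (hz : Q.detPoly.IsRoot z) =>
    continuousPolyFamily_detPoly.exists_isRoot_mem_connectedComponentIn
      (P.isCompact_perturbations w ε) (P.convex_perturbations w ε).isPreconnected
      (self_mem_perturbations hw hε) (by rwa [coeff_detPoly]) (P.pseudospectrum_eq w ε) huniv hgood
      hQ hz
  refine ⟨fun z hz => ?_, ?_⟩
  · obtain ⟨Q, hQ, hroot⟩ := mem_pseudospectrum.mp hz
    obtain ⟨a, ha, har⟩ := (key Q hQ z hroot).1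
    exact ⟨a, mem_eigenvalues.mpr har, ha⟩
  · rintro ⟨Q, hQ, hmult⟩ hsep
    obtain ⟨z, hz⟩ := hasMultipleEigenvalue_iff.mp hmult
    obtain ⟨a, ha, a', ha', hne, har, har'⟩ :=
      (key Q hQ z (dvd_iff_isRoot.mp ((dvd_pow_self _ two_ne_zero).trans hz))).2 hz
        (not_sq_dvd_detPoly hsimple)
    refine hne (hsep a (mem_eigenvalues.mpr har) a' (mem_eigenvalues.mpr har') ?_).symm
    rwa [← connectedComponentIn_eq ha]

theorem pseudospectrum_ne_univ_of_isBounded (h : Bornology.IsBounded (P.pseudospectrum w ε)) :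
    P.pseudospectrum w ε ≠ univ := by
  intro huniv
  rw [huniv] at h
  exact NormedSpace.unbounded_univ ℂ ℂ h

theorem pseudospectrum_eq_univ {Q : MatPoly n m} (hQ : Q ∈ P.perturbations w ε)
    (h : Q.detPoly = 0) : P.pseudospectrum w ε = univ :=
  eq_univ_of_forall fun z => mem_pseudospectrum.mpr ⟨Q, hQ, by simp [h]⟩

/-- If two eigenvalues share a component of some bounded pseudospectrum, the first level at which
this happens is the first level of a multiple eigenvalue. -/
theorem isLeast_of_not_separatesEigenvalues (hw : ∀ j, 0 ≤ w j) (hw0 : 0 < w 0)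
    (hlead : (P (Fin.last m)).det ≠ 0) (hsimple : ∀ z ∈ P.eigenvalues, P.algMultiplicity z = 1)
    {ε₀ : ℝ} (hε₀ : 0 < ε₀) (hbdd : Bornology.IsBounded (P.pseudospectrum w ε₀))
    (hnot : ¬ P.SeparatesEigenvalues w ε₀) :
    IsLeast (P.multipleLevels w) (P.distMultiple w) ∧
      IsLeast (P.fewComponentsLevels w) (P.distMultiple w) := by
  have hfin := finite_eigenvalues hlead
  have hb : ∀ ε ≤ ε₀, Bornology.IsBounded (P.pseudospectrum w ε) :=
    fun ε h => hbdd.subset (pseudospectrum_mono hw h)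
  have hgood : ∀ ε, 0 ≤ ε → ε ≤ ε₀ → P.ComponentsContainEigenvalue w ε ∧
      ((∃ Q ∈ P.perturbations w ε, Q.HasMultipleEigenvalue) → ¬ P.SeparatesEigenvalues w ε) :=
    fun ε h0 h => componentsContainEigenvalue_and hw h0 hlead hsimple
      (pseudospectrum_ne_univ_of_isBounded (hb ε h)) (Or.inl (hb ε h))
  set s := {ε | 0 < ε ∧ ¬ P.SeparatesEigenvalues w ε} with hs
  have hsbdd : BddBelow s := ⟨0, fun ε h => h.1.le⟩
  have hmem : ε₀ ∈ s := ⟨hε₀, hnot⟩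
  set e := sInf s with he
  have heε₀ : e ≤ ε₀ := csInf_le hsbdd hmem
  have he0 : 0 ≤ e := le_csInf ⟨ε₀, hmem⟩ fun ε h => h.1.le
  have hbelow : ∀ δ, 0 < δ → δ < e → P.SeparatesEigenvalues w δ := by
    intro δ hδ hδe
    by_contra h
    exact absurd (csInf_le hsbdd (show δ ∈ s from ⟨hδ, h⟩)) (not_le.mpr hδe)
  -- Separation at e would persist slightly above e, so the infimum belongs to `s`.
  have hnote : ¬ P.SeparatesEigenvalues w e := by
    intro hsep
    have hlt : e < ε₀ := heε₀.lt_of_ne fun h => hnot (h ▸ hsep)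
    obtain ⟨δ, hδ, hsepδ⟩ := hsep.exists_gt hw he0 hlt hbdd hfin
    have : δ ≤ e := le_csInf ⟨ε₀, hmem⟩ fun ε h => by
      by_contra! hlt'
      exact h.2 (hsepδ.mono hw hlt'.le)
    linarith
  have hepos : 0 < e := he0.lt_of_ne fun h => hnote (h ▸ separatesEigenvalues_zero w hfin)
  have hcover : ∀ z ∈ P.pseudospectrum w e, ∃ a ∈ P.eigenvalues, z ∈ closure (P.sweep w e a) :=
    fun z hz => exists_mem_closure_sweep hw hepos hfin
      (fun δ hδ hδe => ⟨δ, le_rfl, hδe, (hgood δ hδ.le (hδe.le.trans heε₀)).1⟩)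
      (fun Q hQ h => pseudospectrum_ne_univ_of_isBounded (hb e heε₀) (pseudospectrum_eq_univ hQ h))
      hz
  obtain ⟨μ, hμ⟩ := exists_componentsMeetAt hw hepos hfin hcover hbelow hnote
  obtain ⟨Q, hQ, hdvd⟩ := hμ.exists_sq_dvd hw hw0 hepos
  have hmult : IsLeast (P.multipleLevels w) e := by
    refine ⟨⟨hepos, Q, hQ, hasMultipleEigenvalue_iff.mpr ⟨μ, hdvd⟩⟩, ?_⟩
    rintro ε ⟨hε, hεm⟩
    by_contra! hlt
    exact (hgood ε hε.le (hlt.le.trans heε₀)).2 hεm (hbelow ε hε hlt)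
  rw [distMultiple, hmult.csInf_eq]
  refine ⟨hmult, ⟨hepos, (hgood e he0 heε₀).1.numComponents_lt hw hlead hsimple he0 hnote⟩, ?_⟩
  rintro ε ⟨hε, hεf⟩
  by_contra! hlt
  exact absurd ((hbelow ε hε hlt).le_numComponents hw hlead hsimple hε.le) (not_le.mpr hεf)

section Large

open scoped Matrix.Norms.L2Operator

/-- For large levels, the pseudospectrum contains a given ball. -/
theorem exists_ball_subset_pseudospectrum (P : MatPoly n m) (hn : 0 < n) (hw : ∀ j, 0 ≤ w j)
    (hw0 : 0 < w 0) (R : ℝ) : ∃ ε > 0, Metric.closedBall 0 R ⊆ P.pseudospectrum w ε := by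
  have hcont : Continuous fun z : ℂ => ‖P.eval z‖ := by
    unfold eval
    fun_prop
  obtain ⟨M, hM⟩ := ((isCompact_closedBall (0 : ℂ) R).image hcont).bddAbove
  -- The constant coefficient may then change by |M| + 1, enough to subtract P(z) from it and make
  -- the value at z zero.
  refine ⟨(|M| + 1) / w 0, by positivity, fun z hz => ?_⟩
  have hz' : ‖P.eval z‖ ≤ M := hM ⟨z, hz, rfl⟩
  refine ⟨P - Pi.single 0 (P.eval z), fun j => ?_, ?_⟩
  · rcases eq_or_ne j 0 with rfl | hj
    · rw [Pi.sub_apply, Pi.single_eq_same, sub_sub_cancel_left, norm_neg,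
        div_mul_cancel₀ _ hw0.ne']
      linarith [le_abs_self M]
    · rw [Pi.sub_apply, Pi.single_eq_of_ne hj, sub_zero, sub_self, norm_zero]
      have := hw j
      positivity
  · have h : (P - Pi.single 0 (P.eval z) : MatPoly n m).eval z = 0 := by
      have h1 : ∀ j : Fin (m + 1), z ^ (j : ℕ) • (P - Pi.single 0 (P.eval z) : MatPoly n m) j =
          z ^ (j : ℕ) • P j - if j = 0 then P.eval z else 0 := by
        intro j
        rcases eq_or_ne j 0 with rfl | hj
        · simp
        · simp [hj]
      rw [eval, Finset.sum_congr rfl fun j _ => h1 j, Finset.sum_sub_distrib]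
      simp [eval]
    have : Nonempty (Fin n) := ⟨⟨0, hn⟩⟩
    change (eval _ z).det = 0
    rw [h, Matrix.det_zero]

end Large

/-- If there are at least two eigenvalues, two eigenvalues share a component at some level. -/
theorem exists_not_separatesEigenvalues (hw : ∀ j, 0 ≤ w j) (hw0 : 0 < w 0)
    (hlead : (P (Fin.last m)).det ≠ 0) (hsimple : ∀ z ∈ P.eigenvalues, P.algMultiplicity z = 1)
    (hnm : 2 ≤ n * m) : ∃ ε > 0, ¬ P.SeparatesEigenvalues w ε := by
  have hfin := finite_eigenvalues hlead
  obtain ⟨a, ha, a', ha', hne⟩ : ∃ a ∈ P.eigenvalues, ∃ a' ∈ P.eigenvalues, a ≠ a' := by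
    have : 1 < P.eigenvalues.ncard := by rw [ncard_eigenvalues hlead hsimple]; exact hnm
    obtain ⟨a, a', ha, ha', hne⟩ := (Set.one_lt_ncard_iff hfin).mp this
    exact ⟨a, ha, a', ha', hne⟩
  obtain ⟨R, hR⟩ := hfin.isBounded.subset_closedBall 0
  obtain ⟨ε, hε, hball⟩ :=
    P.exists_ball_subset_pseudospectrum (Nat.pos_of_ne_zero fun h => by simp [h] at hnm) hw hw0 R
  exact ⟨ε, hε, fun h => hne (h a ha a' ha'
    ((convex_closedBall _ _).isPreconnected.subset_connectedComponentIn
      (hR ha) hball (hR ha'))).symm⟩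

/-- The case of an unbounded pseudospectrum. -/
theorem isLeast_of_componentsMeetAt (hw : ∀ j, 0 ≤ w j) (hw0 : 0 < w 0)
    (hlead : (P (Fin.last m)).det ≠ 0) (hsimple : ∀ z ∈ P.eigenvalues, P.algMultiplicity z = 1)
    (hε : 0 < ε) (hdec : ∀ δ ∈ P.decreaseLevels w, ε ≤ δ) {μ : ℂ} (hμ : P.ComponentsMeetAt w ε μ) :
    IsLeast (P.multipleLevels w) (P.distMultiple w) ∧
      IsLeast (P.decreaseLevels w) (P.distMultiple w) := by
  have hfin := finite_eigenvalues hlead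
  obtain ⟨Q, hQ, hdvd⟩ := hμ.exists_sq_dvd hw hw0 hε
  obtain ⟨z₁, z₂, hdiff, h₁, h₂⟩ := hμ
  have huniv : ∀ δ, 0 < δ → δ < ε → P.pseudospectrum w δ ≠ univ := by
    intro δ hδ hδε h
    refine hdiff δ hδ hδε ?_
    rw [h]
    simp [connectedComponentIn_univ]
  -- levels at which the behaviour at infinity is controlled are cofinal
  have hcofinal : ∀ δ, 0 < δ → δ < ε → ∃ δ', δ ≤ δ' ∧ δ' < ε ∧
      P.ComponentsContainEigenvalue w δ' ∧
      ((∃ Q ∈ P.perturbations w δ', Q.HasMultipleEigenvalue) →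
        ¬ P.SeparatesEigenvalues w δ') := by
    intro δ hδ hδε
    by_cases hb : Bornology.IsBounded (P.pseudospectrum w δ)
    · exact ⟨δ, le_rfl, hδε, componentsContainEigenvalue_and hw hδ.le hlead hsimple
        (huniv δ hδ hδε) (Or.inl hb)⟩
    · obtain ⟨δ', hδ', hδε'⟩ := exists_between hδε
      exact ⟨δ', hδ'.le, hδε', componentsContainEigenvalue_and hw (hδ.trans hδ').le hlead hsimple
        (huniv δ' (hδ.trans hδ') hδε')
        (Or.inr (exists_forall_mem_of_not_isBounded hw hlead hb hδ'))⟩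
  obtain ⟨δ₀, hδ₀, hδε₀, hsep₀⟩ : ∃ δ₀, 0 < δ₀ ∧ δ₀ < ε ∧ P.SeparatesEigenvalues w δ₀ := by
    obtain ⟨ε₁, hε₁, hbdd⟩ := exists_isBounded_pseudospectrum hw hw0 hlead
    obtain ⟨δ, hδ, hsep⟩ :=
      (separatesEigenvalues_zero w hfin).exists_gt hw le_rfl hε₁ hbdd hfin
    exact ⟨min δ (ε / 2), lt_min hδ (by linarith), (min_le_right _ _).trans_lt (by linarith),
      hsep.mono hw (min_le_left _ _)⟩
  have hcount : ∀ δ, δ₀ ≤ δ → δ < ε → ((n * m : ℕ) : ℕ∞) ≤ P.numComponents w δ := by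
    intro δ hδ hδε
    refine (hsep₀.le_numComponents hw hlead hsimple hδ₀.le).trans ?_
    rcases hδ.eq_or_lt with rfl | hlt
    · exact le_rfl
    · by_contra! h
      exact absurd (hdec δ ⟨hδ₀.trans hlt, δ₀, hδ₀, hlt, h⟩) (not_le.mpr hδε)
  -- Lost separation would persist up to a controlled level δ' < ε, where the count would fall below
  -- nm.
  have hsep : ∀ δ, 0 < δ → δ < ε → P.SeparatesEigenvalues w δ := by
    intro δ hδ hδε
    obtain ⟨δ', hδ', hδε', hE, -⟩ := hcofinal (max δ δ₀) (lt_max_of_lt_left hδ) (max_lt hδε hδε₀)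
    by_contra hnot
    have hpos : 0 < δ' := (lt_max_of_lt_left hδ).trans_le hδ'
    exact absurd (hcount δ' ((le_max_right _ _).trans hδ') hδε') (not_le.mpr
      (hE.numComponents_lt hw hlead hsimple hpos.le
        fun h => hnot (h.mono hw ((le_max_left _ _).trans hδ'))))
  have hmult : IsLeast (P.multipleLevels w) ε := by
    refine ⟨⟨hε, Q, hQ, hasMultipleEigenvalue_iff.mpr ⟨μ, hdvd⟩⟩, ?_⟩
    rintro δ ⟨hδ, R, hR, hRm⟩
    by_contra! hlt
    obtain ⟨δ', hδ', hδε', -, hno⟩ := hcofinal δ hδ hlt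
    exact hno ⟨R, perturbations_mono hw hδ' hR, hRm⟩ (hsep δ' (hδ.trans_le hδ') hδε')
  -- an eigenvalue in the component through each of the two points
  have hmeet : ∀ z, μ ∈ closure (P.sweep w ε z) → ∃ δ, 0 < δ ∧ δ < ε ∧
      z ∈ P.pseudospectrum w δ := by
    intro z hz
    obtain ⟨x, hx⟩ := closure_nonempty_iff.mp ⟨μ, hz⟩
    obtain ⟨δ, hδ, hδε, hxδ⟩ := mem_sweep.mp hx
    exact ⟨δ, hδ, hδε, connectedComponentIn_nonempty_iff.mp ⟨x, hxδ⟩⟩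
  obtain ⟨δ₁, hδ₁, hδε₁, hz₁⟩ := hmeet z₁ h₁
  obtain ⟨δ₂, hδ₂, hδε₂, hz₂⟩ := hmeet z₂ h₂
  obtain ⟨δ, hδ, hδε, hE, -⟩ :=
    hcofinal (max δ₁ δ₂) (lt_max_of_lt_left hδ₁) (max_lt hδε₁ hδε₂)
  have hδpos : 0 < δ := (lt_max_of_lt_left hδ₁).trans_le hδ
  obtain ⟨a₁, ha₁, haz₁⟩ := hE z₁ (pseudospectrum_mono hw ((le_max_left _ _).trans hδ) hz₁)
  obtain ⟨a₂, ha₂, haz₂⟩ := hE z₂ (pseudospectrum_mono hw ((le_max_right _ _).trans hδ) hz₂)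
  have hne : a₂ ≠ a₁ := by
    rintro rfl
    refine hdiff δ hδpos hδε ?_
    rw [connectedComponentIn_eq haz₁]
    exact mem_component_symm haz₂
  -- Both closed swept regions contain μ, so they lie in one component at level ε.
  have hnot : ¬ P.SeparatesEigenvalues w ε := by
    intro h
    refine hne (h a₁ ha₁ a₂ ha₂ ?_)
    rw [← connectedComponentIn_eq (component_mono hw hδε.le z₁ haz₁),
      connectedComponentIn_eq (closure_sweep_subset hw h₁),
      ← connectedComponentIn_eq (closure_sweep_subset hw h₂)]
    exact component_mono hw hδε.le z₂ haz₂
  -- At ε itself the behaviour near infinity may be uncontrolled. The property passes to the limit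
  -- from lower levels by Hurwitz, unless some determinant vanishes identically, and then Λ_ε is the
  -- plane.
  have hEε : P.ComponentsContainEigenvalue w ε := by
    intro z hz
    by_cases hzero : ∃ R ∈ P.perturbations w ε, R.detPoly = 0
    · obtain ⟨R, hR, h0⟩ := hzero
      refine ⟨a₁, ha₁, ?_⟩
      rw [pseudospectrum_eq_univ hR h0]
      simp [connectedComponentIn_univ]
    · push Not at hzero
      obtain ⟨a, ha, hza⟩ := exists_mem_closure_sweep hw hε hfin (fun δ hδ hδε => by
        obtain ⟨δ', h1, h2, h3, -⟩ := hcofinal δ hδ hδε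
        exact ⟨δ', h1, h2, h3⟩) hzero hz
      exact ⟨a, ha, mem_component_symm (closure_sweep_subset hw hza)⟩
  rw [distMultiple, hmult.csInf_eq]
  exact ⟨hmult, ⟨hε, δ₀, hδ₀, hδε₀, (hEε.numComponents_lt hw hlead hsimple hε.le hnot).trans_le
    (hcount δ₀ le_rfl hδε₀)⟩, fun δ hδ => hdec δ hδ⟩

end MatPoly

theorem mainTheorem5 (n m : ℕ) (P : MatPoly n m) (w : Fin (m + 1) → ℝ)
    (hw : ∀ j, 0 ≤ w j) (hw0 : 0 < w 0)
    (hlead : (P (Fin.last m)).det ≠ 0)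
    (hsimple : ∀ z ∈ P.eigenvalues, P.algMultiplicity z = 1) :
    -- (a) bounded case, with the bound at a level at which one of the two minima is reached
    (∀ ε : ℝ, 0 < ε → Bornology.IsBounded (P.pseudospectrum w ε) →
      (ε ∈ P.multipleLevels w ∨ ε ∈ P.fewComponentsLevels w) →
        IsLeast (P.multipleLevels w) (P.distMultiple w) ∧
        IsLeast (P.fewComponentsLevels w) (P.distMultiple w)) ∧
    -- (a) bounded case, all levels bounded: both minima exist
    (2 ≤ n * m → (∀ ε : ℝ, 0 < ε → Bornology.IsBounded (P.pseudospectrum w ε)) →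
        IsLeast (P.multipleLevels w) (P.distMultiple w) ∧
        IsLeast (P.fewComponentsLevels w) (P.distMultiple w)) ∧
    -- (b) unbounded case, components first meeting away from the origin
    (∀ ε : ℝ, 0 < ε → ¬ Bornology.IsBounded (P.pseudospectrum w ε) →
      (∀ δ ∈ P.decreaseLevels w, ε ≤ δ) →
      (∃ μ : ℂ, μ ≠ 0 ∧ P.ComponentsMeetAt w ε μ) →
        IsLeast (P.multipleLevels w) (P.distMultiple w) ∧
        IsLeast (P.decreaseLevels w) (P.distMultiple w)) := by
  refine ⟨fun ε hε hbdd h => ?_, fun hnm hbdd => ?_, fun ε hε _ hdec ⟨μ, _, hμ⟩ => ?_⟩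
  · refine MatPoly.isLeast_of_not_separatesEigenvalues hw hw0 hlead hsimple hε hbdd ?_
    rcases h with ⟨-, h⟩ | ⟨-, h⟩
    · exact (MatPoly.componentsContainEigenvalue_and hw hε.le hlead hsimple
        (MatPoly.pseudospectrum_ne_univ_of_isBounded hbdd) (Or.inl hbdd)).2 h
    · exact fun hsep => absurd (hsep.le_numComponents hw hlead hsimple hε.le) (not_le.mpr h)
  · obtain ⟨ε, hε, hnot⟩ := MatPoly.exists_not_separatesEigenvalues hw hw0 hlead hsimple hnm
    exact MatPoly.isLeast_of_not_separatesEigenvalues hw hw0 hlead hsimple hε (hbdd ε hε) hnot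
  · exact MatPoly.isLeast_of_componentsMeetAt hw hw0 hlead hsimple hε hdec hμ
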